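/- Let $n\ge 0$ be an integer and $d=2^n$. Let $\sigma_{(0,0)}=\left(\begin{smallmatrix}1&0\\0&1\end{smallmatrix}\right)$, $\sigma_{(0,1)}=\left(\begin{smallmatrix}0&1\\1&0\end{smallmatrix}\right)$, $\sigma_{(1,0)}=\left(\begin{smallmatrix}1&0\\0&-1\end{smallmatrix}\right)$, $\sigma_{(1,1)}=\left(\begin{smallmatrix}0&-i\\i&0\end{smallmatrix}\right)$ be the Pauli matrices, and for $a\in\mathbb{Z}_2^{2n}$ let $W_a=\sigma_{(a_1,a_2)}\otimes\cdots\otimes\sigma_{(a_{2n-1},a_{2n})}$, a unitary operator on $(\mathbb{C}^2)^{\otimes n}\simeq\mathbb{C}^d$. The Pauli group $\mathcal{P}_n$ is the subgroup of $U(d)$ generated by all $W_a$, and the Clifford group $\mathrm{Cl}_n$ is the normalizer of $\mathcal{P}_n$ in $U(d)$. Let $z\in\mathbb{C}^d$ with $\|z\|_{\ell_2}=1$. Then the Clifford orbit $\mathrm{Cl}_n\cdot zz^*=\{Uzz^*U^\dagger : U\in\mathrm{Cl}_n\}$ is a finite set. Let $a$ be a random vector in $\mathbb{C}^d$ (determined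 up to a phase) such that $aa^*$ is uniformly distributed on $\mathrm{Cl}_n\cdot zz^*$. For every Hermitian $d\times d$ matrix $Z$, the random variable $S_Z:=\langle a,Za\rangle$ has finite second and fourth moments, and $$\mathbb{E}\left[S_Z^2\right]=\frac{\|Z\|_2^2+\mathrm{tr}(Z)^2}{(d+1)d},$$ $$\mathbb{E}\left[S_Z^4\right]\le\left(\frac{6}{d}\,\left\|\Xi(zz^*)\right\|_{\ell_4}^4\,\frac{\|Z\|_1^2}{\|Z\|_2^2}+13\right)\mathbb{E}\left[S_Z^2\right]^2 .$$ Here $\Xi(zz^*)(a)=\mathrm{tr}(W_a\,zz^*)$ for $a\in\mathbb{Z}_2^{2n}$, $\|\Xi(zz^*)\|_{\ell_4}=\big(\sum_{a\in\mathbb{Z}_2^{2n}}\mathrm{tr}(W_a\,zz^*)^4\big)^{1/4}$, $\|Z\|_1=\sum_{k=1}^d|\lambda_k(Z)|$ is the nuclear norm ($\lambda_k(Z)$ being the eigenvalues of $Z$) and $\|Z\|_2=\sqrt{\mathrm{tr}(Z^2)}$ is the Frobenius norm; for $Z=0$ the quotient $\|Z\|_1^2/\|Z\|_2^2$ is read as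 $0$. -/

import Mathlib

open MeasureTheory ProbabilityTheory Matrix

namespace CliffordOrbit

noncomputable section

/-- Labels of the standard basis of `(ℂ²)^{⊗ n} ≃ ℂ^(2^n)`: bit strings of length `n`. -/
abbrev Idx (n : ℕ) : Type := Fin n → Fin 2

/-- Labels `(a₁, a₂, …, a₂ₙ)` of Pauli operators, grouped in pairs `(a₂ᵢ₋₁, a₂ᵢ)`. -/
abbrev PauliLabel (n : ℕ) : Type := Fin n → Fin 2 × Fin 2

/-- The Hilbert space `ℂ^(2^n)` with the Euclidean norm. -/
abbrev Vec (n : ℕ) : Type := EuclideanSpace ℂ (Idx n)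

/-- Complex `2^n × 2^n` matrices. -/
abbrev Mat (n : ℕ) : Type := Matrix (Idx n) (Idx n) ℂ

/-- The four Pauli matrices on `ℂ²`. -/
def sigma : Fin 2 × Fin 2 → Matrix (Fin 2) (Fin 2) ℂ
  | (0, 0) => !![1, 0; 0, 1]
  | (0, 1) => !![0, 1; 1, 0]
  | (1, 0) => !![1, 0; 0, -1]
  | (1, 1) => !![0, -Complex.I; Complex.I, 0]

/-- The Pauli operator `W_a = σ_{(a₁,a₂)} ⊗ ⋯ ⊗ σ_{(a₂ₙ₋₁,a₂ₙ)}`, given by the entries of the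
`n`-fold Kronecker product. -/
def pauli {n : ℕ} (a : PauliLabel n) : Mat n :=
  Matrix.of fun x y => ∏ i, sigma (a i) (x i) (y i)

theorem sigma_mul_conjTranspose (p : Fin 2 × Fin 2) : sigma p * (sigma p)ᴴ = 1 := by
  obtain ⟨p, q⟩ := p
  fin_cases p <;> fin_cases q <;> ext i j <;> fin_cases i <;> fin_cases j <;>
    simp [sigma, Matrix.mul_apply, Fin.sum_univ_two]

theorem pauli_mem_unitaryGroup {n : ℕ} (a : PauliLabel n) :
    pauli a ∈ Matrix.unitaryGroup (Idx n) ℂ := by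
  rw [Matrix.mem_unitaryGroup_iff]
  ext x y
  have h : ∀ i, ∑ w, sigma (a i) (x i) w * star (sigma (a i) (y i) w)
      = (1 : Matrix (Fin 2) (Fin 2) ℂ) (x i) (y i) := by
    intro i
    rw [← sigma_mul_conjTranspose (a i), Matrix.mul_apply]
    rfl
  have h1 : (pauli a * star (pauli a)) x y
      = ∏ i, ∑ w, sigma (a i) (x i) w * star (sigma (a i) (y i) w) := by
    rw [Matrix.mul_apply, Fintype.prod_sum]
    refine Finset.sum_congr rfl fun w _ => ?_
    simp [pauli, Matrix.star_apply, Finset.prod_mul_distrib]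
  rw [h1, Finset.prod_congr rfl fun i _ => h i]
  by_cases hxy : x = y
  · subst hxy; simp
  · obtain ⟨i, hi⟩ := Function.ne_iff.mp hxy
    rw [Matrix.one_apply_ne hxy]
    exact Finset.prod_eq_zero (Finset.mem_univ i) (Matrix.one_apply_ne hi)

/-- The Pauli operators as elements of the unitary group `U(2^n)`. -/
def pauliUnitary {n : ℕ} (a : PauliLabel n) : Matrix.unitaryGroup (Idx n) ℂ :=
  ⟨pauli a, pauli_mem_unitaryGroup a⟩

/-- The Pauli group: the subgroup of `U(2^n)` generated by all Pauli operators. -/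
def pauliGroup (n : ℕ) : Subgroup (Matrix.unitaryGroup (Idx n) ℂ) :=
  Subgroup.closure (Set.range pauliUnitary)

/-- The Clifford group: the normalizer of the Pauli group inside `U(2^n)`. -/
def cliffordGroup (n : ℕ) : Subgroup (Matrix.unitaryGroup (Idx n) ℂ) :=
  Subgroup.normalizer (pauliGroup n : Set (Matrix.unitaryGroup (Idx n) ℂ))

/-- The rank-one operator `v v^*`. -/
def proj {n : ℕ} (v : Vec n) : Mat n :=
  Matrix.of fun x y => v x * star (v y)

/-- The Clifford orbit `Cl_n · z z^* = {U z z^* U^† | U ∈ Cl_n}`. -/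
def cliffordOrbit {n : ℕ} (z : Vec n) : Set (Mat n) :=
  {A | ∃ U ∈ cliffordGroup n, A = (U : Mat n) * proj z * (U : Mat n)ᴴ}

/-- The Borel `σ`-algebra on matrices: the product one on the entries. -/
instance instMeasurableSpaceMat (n : ℕ) : MeasurableSpace (Mat n) :=
  inferInstanceAs (MeasurableSpace (Idx n → Idx n → ℂ))

/-- The random vector `a` (determined up to a phase) is drawn uniformly from the Clifford orbit of
`z`: the law of `a a^*` is the uniform distribution on the set `Cl_n · z z^*`. -/
def IsUniformOnOrbit {n : ℕ} {Ω : Type*} [MeasurableSpace Ω] (P : Measure Ω)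
    (a : Ω → Vec n) (z : Vec n) : Prop :=
  P.map (fun ω => proj (a ω)) = uniformOn (cliffordOrbit z)

/-- The quadratic form `⟨v, Z v⟩`, which is real for Hermitian `Z`. -/
def quadForm {n : ℕ} (Z : Mat n) (v : Vec n) : ℝ :=
  (inner ℂ v (Matrix.toEuclideanLin Z v)).re

/-- The characteristic function `Ξ(Z)(a) = tr(W_a Z)`, which is real for Hermitian `Z`. -/
def charFn {n : ℕ} (Z : Mat n) (a : PauliLabel n) : ℝ :=
  (Matrix.trace (pauli a * Z)).re

/-- The `ℓ₄`-norm of a real function on the set of Pauli labels. -/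
def l4norm {n : ℕ} (f : PauliLabel n → ℝ) : ℝ :=
  (∑ a, |f a| ^ 4) ^ (1 / 4 : ℝ)

/-- The nuclear norm of a Hermitian matrix: the `ℓ₁`-norm of its vector of eigenvalues. -/
def nuclearNorm {n : ℕ} {Z : Mat n} (hZ : Z.IsHermitian) : ℝ :=
  ∑ k, |hZ.eigenvalues k|

/-- The Frobenius norm `√(tr (Z²))` of a Hermitian matrix. -/
def frobNorm {n : ℕ} (Z : Mat n) : ℝ :=
  Real.sqrt (Matrix.trace (Z * Z)).re

end

end CliffordOrbit

open CliffordOrbit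

/-! Write d = 2^n. Only a a* matters for S_Z, so the k-th moment of S_Z is the average over the
finite orbit of tr(Z M)^k. Polarized, it is a symmetric k-linear form F on matrices with two further
properties. It is invariant under conjugation by Clifford unitaries. Since M has rank one, M ⊗ M
absorbs the swap of two tensor factors; as Σ_v W_v ⊗ W_v = d · SWAP, this reads Σ_v F(A W_v, B W_v,
…) = d F(A, B, …). The structures `IsCliffordForm₂` and `IsCliffordForm₄` record these properties,
with invariance asked only for the rotations (1 + iW_u)/√2 up to a phase.

The core is a uniqueness statement. An invariant bilinear form is determined by F(1,1)
(`IsCliffordForm₂.eq_zero`), and an invariant quadrilinear form by F(1,1,1,1) and Σ_v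
F(W_v,W_v,W_v,W_v) (`IsCliffordForm₄.eq_zero`). By multilinearity only Pauli arguments matter.
Rotations identify or annihilate most values. The remaining ones satisfy linear equations, obtained
by weighting the swap identity with the characters v ↦ comm c v so that only labels with prescribed
commutation signs survive.

For k = 2 this gives the second moment at once. For k = 4, two explicit invariant forms are
available: `permForm`, the trace against the sum of all 24 permutation operators, and `pauliForm`,
its twist by Σ_a W_a^{⊗4}. Hence the fourth moment is p · `pauliForm` + q · `permForm`, where p and
q solve a 2 × 2 system whose only dependence on z is through L = ‖Ξ(zz*)‖₄⁴ (`orbitForm₄_eq`,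
`exists_coefficients`).

It remains to estimate. `permForm_self_le` gives the constant 13. `norm_pauliForm_self_le` bounds
`pauliForm` at Z by 24 d ‖Z‖₁² ‖Z‖₂², using Parseval for the commutation characters in an eigenbasis
of Z. The bounds 2d/(d+1) ≤ L ≤ d² control p and q. -/

namespace CliffordOrbit

/-! ### Algebra of Pauli operators -/

/-- The commutation sign of two one-qubit Pauli labels. -/
def sgn (p q : Fin 2 × Fin 2) : ℂ := if p.1 * q.2 + p.2 * q.1 = 0 then 1 else -1

/-- The commutation sign of two Pauli labels: `W_a W_b = comm a b • W_b W_a`. -/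
noncomputable def comm {n : ℕ} (a b : PauliLabel n) : ℂ := ∏ i, sgn (a i) (b i)

theorem fin_two_prod_add_self (p : Fin 2 × Fin 2) : p + p = 0 := by
  revert p; decide

theorem sgn_symm (p q : Fin 2 × Fin 2) : sgn p q = sgn q p := by
  have : p.1 * q.2 + p.2 * q.1 = q.1 * p.2 + q.2 * p.1 := by revert p q; decide
  simp [sgn, this]

theorem sgn_self (p : Fin 2 × Fin 2) : sgn p p = 1 := by
  have : p.1 * p.2 + p.2 * p.1 = 0 := by revert p; decide
  simp [sgn, this]

theorem sgn_eq (p q : Fin 2 × Fin 2) : sgn p q = 1 ∨ sgn p q = -1 := by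
  unfold sgn; split_ifs <;> simp

theorem sgn_add (p q r : Fin 2 × Fin 2) : sgn (p + q) r = sgn p r * sgn q r := by
  obtain ⟨p, p'⟩ := p
  obtain ⟨q, q'⟩ := q
  obtain ⟨r, r'⟩ := r
  fin_cases p <;> fin_cases p' <;> fin_cases q <;> fin_cases q' <;> fin_cases r <;> fin_cases r' <;>
    simp [sgn]

theorem sum_sgn (p : Fin 2 × Fin 2) : ∑ q, sgn p q = if p = 0 then 4 else 0 := by
  obtain ⟨p, p'⟩ := p
  fin_cases p <;> fin_cases p' <;>
    simp [sgn, Fintype.sum_prod_type, Fin.sum_univ_two, Prod.ext_iff]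

/-- Only the fourth power of the phase is recorded: it makes phases disappear from every expression
of degree four in the Pauli operators. -/
theorem sigma_mul (p q : Fin 2 × Fin 2) :
    ∃ c : ℂ, c ^ 4 = 1 ∧ sigma p * sigma q = c • sigma (p + q) := by
  have hI : Complex.I ^ 4 = 1 := Complex.I_pow_four
  have hI' : (-Complex.I) ^ 4 = 1 := by rw [neg_pow, hI]; norm_num
  obtain ⟨p, p'⟩ := p
  obtain ⟨q, q'⟩ := q
  have key : ∃ c : ℂ, (c = 1 ∨ c = Complex.I ∨ c = -Complex.I) ∧
      sigma (p, p') * sigma (q, q') = c • sigma ((p, p') + (q, q')) := by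
    fin_cases p <;> fin_cases p' <;> fin_cases q <;> fin_cases q' <;>
    first
    | (refine ⟨1, by simp, ?_⟩
       ext i j; fin_cases i <;> fin_cases j <;>
         simp [sigma, Matrix.mul_apply, Fin.sum_univ_two] <;> done)
    | (refine ⟨Complex.I, by simp, ?_⟩
       ext i j; fin_cases i <;> fin_cases j <;>
         simp [sigma, Matrix.mul_apply, Fin.sum_univ_two] <;> done)
    | (refine ⟨-Complex.I, by simp, ?_⟩
       ext i j; fin_cases i <;> fin_cases j <;>
         simp [sigma, Matrix.mul_apply, Fin.sum_univ_two])
  obtain ⟨c, hc, h⟩ := key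
  refine ⟨c, ?_, h⟩
  rcases hc with rfl | rfl | rfl <;> simp [hI']

theorem sigma_mul_comm (p q : Fin 2 × Fin 2) : sigma p * sigma q = sgn p q • (sigma q * sigma p) := by
  obtain ⟨p, p'⟩ := p
  obtain ⟨q, q'⟩ := q
  fin_cases p <;> fin_cases p' <;> fin_cases q <;> fin_cases q' <;>
    (ext i j; fin_cases i <;> fin_cases j <;>
      simp [sigma, sgn, Matrix.mul_apply, Fin.sum_univ_two])

theorem sigma_isHermitian (p : Fin 2 × Fin 2) : (sigma p)ᴴ = sigma p := by
  obtain ⟨p, p'⟩ := p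
  fin_cases p <;> fin_cases p' <;>
    (ext i j; fin_cases i <;> fin_cases j <;> simp [sigma])

/-- The entries of Σ_p σ_p ⊗ σ_p = 2 · SWAP on two qubits; `pauli_completeness` is its n-fold tensor
power. -/
theorem sum_sigma (x y x' y' : Fin 2) :
    ∑ p, sigma p x y * sigma p x' y' = if x = y' ∧ y = x' then 2 else 0 := by
  fin_cases x <;> fin_cases y <;> fin_cases x' <;> fin_cases y' <;>
    simp [sigma, Fintype.sum_prod_type, Fin.sum_univ_two] <;> norm_num

/-! ### Commutation signs as characters of the label group, and n-qubit Pauli operators -/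

variable {n : ℕ}

theorem label_add_self (a : PauliLabel n) : a + a = 0 :=
  funext fun i => fin_two_prod_add_self (a i)

theorem label_add_cancel (a b : PauliLabel n) : a + (a + b) = b := by
  rw [← add_assoc, label_add_self, zero_add]

theorem label_add_cancel' (a b : PauliLabel n) : a + b + b = a := by
  rw [add_assoc, label_add_self, add_zero]

theorem label_eq_of_add_eq_zero {a b : PauliLabel n} (h : a + b = 0) : a = b := by
  have := label_add_cancel' a b
  rw [h, zero_add] at this
  exact this.symm

theorem comm_symm (a b : PauliLabel n) : comm a b = comm b a :=
  Finset.prod_congr rfl fun _ _ => sgn_symm _ _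

theorem comm_self (a : PauliLabel n) : comm a a = 1 :=
  Finset.prod_eq_one fun _ _ => sgn_self _

theorem comm_eq (a b : PauliLabel n) : comm a b = 1 ∨ comm a b = -1 := by
  unfold comm
  refine Finset.prod_induction _ (fun c : ℂ => c = 1 ∨ c = -1) ?_ (Or.inl rfl) fun _ _ => sgn_eq _ _
  rintro x y (rfl | rfl) (rfl | rfl) <;> simp

theorem comm_sq (a b : PauliLabel n) : comm a b * comm a b = 1 := by
  rcases comm_eq a b with h | h <;> rw [h] <;> norm_num

theorem comm_add_left (a b c : PauliLabel n) : comm (a + b) c = comm a c * comm b c := by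
  simp [comm, sgn_add, Finset.prod_mul_distrib]

theorem comm_add_right (a b c : PauliLabel n) : comm a (b + c) = comm a b * comm a c := by
  rw [comm_symm, comm_add_left, comm_symm b, comm_symm c]

theorem comm_zero_right (a : PauliLabel n) : comm a 0 = 1 := by
  rw [← label_add_self a, comm_add_right, comm_sq]

theorem comm_zero_left (a : PauliLabel n) : comm 0 a = 1 := by
  rw [comm_symm, comm_zero_right]

/-- Orthogonality of characters: the sum factors over the qubits, and the factor at a qubit where
`a` is nonzero vanishes. -/
theorem sum_comm {a : PauliLabel n} (ha : a ≠ 0) : ∑ b, comm a b = 0 := by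
  unfold comm
  rw [← Fintype.prod_sum fun i q => sgn (a i) q]
  obtain ⟨i, hi⟩ := Function.ne_iff.mp ha
  refine Finset.prod_eq_zero (Finset.mem_univ i) ?_
  rw [sum_sgn]
  exact if_neg hi

theorem exists_comm_eq_neg_one {a : PauliLabel n} (ha : a ≠ 0) : ∃ u, comm u a = -1 := by
  by_contra! h
  have h1 : ∀ u, comm a u = 1 := fun u => by
    rw [comm_symm]; exact (comm_eq u a).resolve_right (h u)
  have := sum_comm ha
  simp [h1] at this

theorem sum_comm_add (a : PauliLabel n) (f : PauliLabel n → ℂ) : ∑ v, f (a + v) = ∑ v, f v :=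
  Equiv.sum_comp (Equiv.addLeft a) f

/-- Tensor products of families of one-qubit operators multiply factorwise. -/
theorem tensor_mul_apply (A B : Fin n → Matrix (Fin 2) (Fin 2) ℂ) (x y : Idx n) :
    ∑ w : Idx n, (∏ i, A i (x i) (w i)) * ∏ i, B i (w i) (y i) = ∏ i, (A i * B i) (x i) (y i) := by
  simp only [Matrix.mul_apply]
  rw [Fintype.prod_sum]
  simp only [Finset.prod_mul_distrib]

theorem pauli_mul_apply (a b : PauliLabel n) (x y : Idx n) :
    (pauli a * pauli b) x y = ∏ i, (sigma (a i) * sigma (b i)) (x i) (y i) := by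
  rw [← tensor_mul_apply, Matrix.mul_apply]
  rfl

theorem pauli_mul (a b : PauliLabel n) :
    ∃ c : ℂ, c ^ 4 = 1 ∧ pauli a * pauli b = c • pauli (a + b) := by
  choose c hc h using fun i => sigma_mul (a i) (b i)
  refine ⟨∏ i, c i, ?_, ?_⟩
  · rw [← Finset.prod_pow]
    exact Finset.prod_eq_one fun i _ => hc i
  · ext x y
    rw [pauli_mul_apply]
    simp [h, pauli, Finset.prod_mul_distrib]

theorem pauli_mul_comm (a b : PauliLabel n) :
    pauli a * pauli b = comm a b • (pauli b * pauli a) := by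
  ext x y
  rw [Matrix.smul_apply, pauli_mul_apply, pauli_mul_apply]
  simp [sigma_mul_comm (a _) (b _), comm, Finset.prod_mul_distrib]

theorem pauli_isHermitian (a : PauliLabel n) : (pauli a)ᴴ = pauli a := by
  ext x y
  rw [Matrix.conjTranspose_apply]
  simp only [pauli, Matrix.of_apply, star_prod]
  refine Finset.prod_congr rfl fun i _ => ?_
  rw [← Matrix.conjTranspose_apply, sigma_isHermitian]

theorem pauli_mul_self (a : PauliLabel n) : pauli a * pauli a = 1 := by
  have := (Matrix.mem_unitaryGroup_iff).mp (pauli_mem_unitaryGroup a)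
  rwa [Matrix.star_eq_conjTranspose, pauli_isHermitian] at this

theorem pauli_zero : pauli (0 : PauliLabel n) = 1 := by
  ext x y
  have : sigma 0 = 1 := by
    ext i j; fin_cases i <;> fin_cases j <;> simp [sigma]
  simp only [pauli, Matrix.of_apply, Pi.zero_apply, this]
  by_cases hxy : x = y
  · subst hxy; simp
  · obtain ⟨i, hi⟩ := Function.ne_iff.mp hxy
    rw [Matrix.one_apply_ne hxy]
    exact Finset.prod_eq_zero (Finset.mem_univ i) (Matrix.one_apply_ne hi)

theorem pauli_completeness (x y x' y' : Idx n) :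
    ∑ a, pauli a x y * pauli a x' y' = if x = y' ∧ y = x' then (2 : ℂ) ^ n else 0 := by
  have h : ∑ a : PauliLabel n, pauli a x y * pauli a x' y'
      = ∏ i, ∑ p, sigma p (x i) (y i) * sigma p (x' i) (y' i) := by
    rw [Fintype.prod_sum]
    simp [pauli, Finset.prod_mul_distrib]
  rw [h]
  simp only [sum_sigma]
  split_ifs with hxy
  · obtain ⟨rfl, rfl⟩ := hxy
    simp
  · rw [not_and_or] at hxy
    have : ∃ i, ¬ (x i = y' i ∧ y i = x' i) := by
      by_contra! hh
      rcases hxy with h1 | h1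
      · exact h1 (funext fun i => (hh i).1)
      · exact h1 (funext fun i => (hh i).2)
    obtain ⟨i, hi⟩ := this
    exact Finset.prod_eq_zero (Finset.mem_univ i) (if_neg hi)

/-- This is tr((P ⊗ Q) · SWAP) = tr(PQ). Its companion `sum_trace_mul_pauli_mul_pauli` contains a
second swap, which splits the trace instead of joining it. -/
theorem sum_trace_mul_pauli_mul_trace (P Q : Mat n) :
    ∑ a, trace (P * pauli a) * trace (Q * pauli a) = (2 : ℂ) ^ n * trace (P * Q) := by
  have h : ∀ a : PauliLabel n, trace (P * pauli a) * trace (Q * pauli a)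
      = ∑ x, ∑ y, ∑ x', ∑ y', P x y * Q x' y' * (pauli a y x * pauli a y' x') := by
    intro a
    simp only [trace, diag_apply, Matrix.mul_apply, Finset.sum_mul_sum]
    refine Finset.sum_congr rfl fun x _ => ?_
    rw [Finset.sum_comm]
    refine Finset.sum_congr rfl fun y _ => Finset.sum_congr rfl fun x' _ =>
      Finset.sum_congr rfl fun y' _ => by ring
  simp only [h]
  rw [Finset.sum_comm]
  simp only [trace, diag_apply, Matrix.mul_apply, Finset.mul_sum]
  refine Finset.sum_congr rfl fun x _ => ?_
  rw [Finset.sum_comm]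
  refine Finset.sum_congr rfl fun y _ => ?_
  rw [Finset.sum_comm]
  have h2 : ∀ x', ∑ a, ∑ y', P x y * Q x' y' * (pauli a y x * pauli a y' x')
      = if y = x' then P x y * Q y x * 2 ^ n else 0 := by
    intro x'
    rw [Finset.sum_comm]
    simp only [← Finset.mul_sum, pauli_completeness]
    split_ifs with hx
    · subst hx
      simp
    · simp [hx]
  simp only [h2]
  simp [mul_comm]

theorem sum_pauli_mul_mul_pauli (Q : Mat n) :
    ∑ a, pauli a * Q * pauli a = ((2 : ℂ) ^ n * trace Q) • (1 : Mat n) := by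
  ext x x'
  have h : ∀ a : PauliLabel n, (pauli a * Q * pauli a) x x'
      = ∑ y', ∑ y, Q y y' * (pauli a x y * pauli a y' x') := by
    intro a
    simp only [Matrix.mul_apply, Finset.sum_mul]
    exact Finset.sum_congr rfl fun _ _ => Finset.sum_congr rfl fun _ _ => by ring
  simp only [Matrix.sum_apply, h]
  rw [Finset.sum_comm]
  have h2 : ∀ y', ∑ a : PauliLabel n, ∑ y, Q y y' * (pauli a x y * pauli a y' x')
      = if x = x' then Q y' y' * 2 ^ n else 0 := by
    intro y'
    rw [Finset.sum_comm]
    simp only [← Finset.mul_sum, pauli_completeness]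
    split_ifs with hx
    · simp [hx]
    · simp [hx]
  simp only [h2]
  by_cases hx : x = x'
  · simp [hx, trace, Finset.mul_sum, mul_comm]
  · simp [hx]

theorem sum_trace_mul_pauli_mul_pauli (P Q : Mat n) :
    ∑ a, trace (P * pauli a * (Q * pauli a)) = (2 : ℂ) ^ n * (trace P * trace Q) := by
  have h : ∀ a : PauliLabel n, P * pauli a * (Q * pauli a) = P * (pauli a * Q * pauli a) :=
    fun a => by simp only [Matrix.mul_assoc]
  simp only [h]
  rw [← trace_sum, ← Finset.mul_sum, sum_pauli_mul_mul_pauli]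
  simp
  ring

theorem pauli_conj_pauli (u a : PauliLabel n) :
    pauli u * pauli a * pauli u = comm u a • pauli a := by
  rw [pauli_mul_comm, Matrix.smul_mul, Matrix.mul_assoc, pauli_mul_self, Matrix.mul_one]

/-- The square of the phase in a product of two Pauli operators is their commutation sign. -/
theorem pauli_mul_sq (a b : PauliLabel n) :
    ∃ c : ℂ, c * c = comm a b ∧ pauli a * pauli b = c • pauli (a + b) := by
  obtain ⟨c, -, hc⟩ := pauli_mul a b
  refine ⟨c, ?_, hc⟩
  have h : pauli a * pauli b * (pauli a * pauli b) = comm a b • 1 := by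
    rw [← Matrix.mul_assoc, pauli_conj_pauli, Matrix.smul_mul, pauli_mul_self]
  rw [hc, Matrix.smul_mul, Matrix.mul_smul, smul_smul, pauli_mul_self] at h
  have := congrFun (congrFun h 0) 0
  simpa using this

/-- Conjugation by an anticommuting Pauli operator preserves the trace and flips the sign. -/
theorem trace_pauli {a : PauliLabel n} (ha : a ≠ 0) : trace (pauli a) = 0 := by
  obtain ⟨u, hu⟩ := exists_comm_eq_neg_one ha
  have h1 : trace (pauli u * pauli a * pauli u) = trace (pauli a) := by
    rw [trace_mul_comm, ← Matrix.mul_assoc, pauli_mul_self, Matrix.one_mul]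
  rw [pauli_mul_comm, hu, Matrix.smul_mul, Matrix.mul_assoc, pauli_mul_self, Matrix.mul_one,
    trace_smul, smul_eq_mul] at h1
  linear_combination (-1 / 2 : ℂ) * h1

theorem trace_one_mat : trace (1 : Mat n) = 2 ^ n := by
  simp [trace_one]

theorem two_pow_ne_zero : (2 : ℂ) ^ n ≠ 0 := pow_ne_zero _ two_ne_zero

theorem card_label : (Fintype.card (PauliLabel n) : ℂ) = (2 ^ n) ^ 2 := by
  rw [← pow_mul, mul_comm n 2, pow_mul]
  simp
  norm_num

theorem trace_pauli_mul_pauli (a b : PauliLabel n) :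
    trace (pauli a * pauli b) = if a = b then (2 : ℂ) ^ n else 0 := by
  split_ifs with h
  · rw [h, pauli_mul_self, trace_one_mat]
  · obtain ⟨c, -, hc⟩ := pauli_mul a b
    rw [hc, trace_smul, trace_pauli, smul_zero]
    exact fun h0 => h (label_eq_of_add_eq_zero h0)

/-- The expansion of a matrix in Pauli operators. -/
theorem sum_trace_smul_pauli (Z : Mat n) :
    ∑ a, trace (Z * pauli a) • pauli a = (2 : ℂ) ^ n • Z := by
  ext x y
  have h := sum_trace_mul_pauli_mul_trace Z (Matrix.single y x (1 : ℂ))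
  have key : ∀ M : Mat n, trace (Matrix.single y x (1 : ℂ) * M) = M x y := by
    intro M
    rw [trace_single_mul, one_smul]
  simp only [key] at h
  rw [trace_mul_comm Z, key] at h
  simpa [Matrix.sum_apply] using h

/-! ### Clifford-invariant forms on matrices -/

/-- The Clifford unitary `(1 + i W_u) / √2`, up to a phase. -/
noncomputable def rot (u : PauliLabel n) : Mat n :=
  ((1 + Complex.I) / 2) • (1 + Complex.I • pauli u)

theorem rot_conj (u : PauliLabel n) (B : Mat n) :
    rot u * B * (rot u)ᴴ =
      (1 / 2 : ℂ) • (B + Complex.I • (pauli u * B) - Complex.I • (B * pauli u)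
        + pauli u * B * pauli u) := by
  have hI : Complex.I * Complex.I = -1 := Complex.I_mul_I
  have h : (rot u)ᴴ = ((1 - Complex.I) / 2) • (1 - Complex.I • pauli u) := by
    simp [rot, conjTranspose_smul, conjTranspose_add, pauli_isHermitian, sub_eq_add_neg]
  rw [h, rot]
  simp only [Matrix.smul_mul, Matrix.mul_smul, smul_smul, Matrix.add_mul, Matrix.mul_sub,
    Matrix.one_mul, Matrix.mul_one, smul_sub, smul_add]
  have h2 : (1 - Complex.I) / 2 * ((1 + Complex.I) / 2) = 1 / 2 := by
    linear_combination (-1 / 4 : ℂ) * hI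
  have h3 : (1 - Complex.I) / 2 * ((1 + Complex.I) / 2 * (Complex.I * Complex.I)) = -(1 / 2) := by
    rw [hI]; linear_combination (1 / 4 : ℂ) * hI
  ext x y
  simp only [Matrix.add_apply, Matrix.sub_apply, Matrix.smul_apply, smul_eq_mul]
  linear_combination (B x y + Complex.I * (pauli u * B) x y - Complex.I * (B * pauli u) x y) * h2
    - (pauli u * B * pauli u) x y * h3

theorem rot_conj_of_comm {u : PauliLabel n} {B : Mat n} (h : pauli u * B = B * pauli u) :
    rot u * B * (rot u)ᴴ = B := by
  rw [rot_conj, h, Matrix.mul_assoc, pauli_mul_self, Matrix.mul_one]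
  ext x y
  simp only [Matrix.add_apply, Matrix.sub_apply, Matrix.smul_apply, smul_eq_mul]
  ring

/-- With `rot_conj_of_comm`, this says that the rotation acts on labels as a symplectic
transvection: W_a goes to itself if it commutes with W_u, and to ±W_{a+u} otherwise. -/
theorem rot_conj_of_anticomm {u : PauliLabel n} {B : Mat n} (h : pauli u * B = -(B * pauli u)) :
    rot u * B * (rot u)ᴴ = (-Complex.I) • (B * pauli u) := by
  rw [rot_conj, h, neg_mul, Matrix.mul_assoc, pauli_mul_self, Matrix.mul_one]
  ext x y
  simp only [Matrix.add_apply, Matrix.sub_apply, Matrix.smul_apply, Matrix.neg_apply, smul_eq_mul]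
  ring

theorem rot_mul_rot (u : PauliLabel n) : rot u * rot u = -pauli u := by
  have hI : Complex.I * Complex.I = -1 := Complex.I_mul_I
  have h : (1 + Complex.I • pauli u) * (1 + Complex.I • pauli u)
      = (2 * Complex.I) • pauli u := by
    rw [Matrix.add_mul, Matrix.mul_add, Matrix.mul_add, Matrix.smul_mul, Matrix.mul_smul,
      Matrix.mul_smul, Matrix.smul_mul, pauli_mul_self, smul_smul, hI, Matrix.one_mul, Matrix.mul_one, Matrix.one_mul, neg_smul,
      one_smul, two_mul, add_smul]
    abel
  rw [rot, Matrix.smul_mul, Matrix.mul_smul, h, smul_smul, smul_smul, ← neg_one_smul ℂ (pauli u)]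
  congr 1
  linear_combination (1 + Complex.I / 2) * hI

/-- Since the rotation squares to -W_u, invariance under rotations already contains invariance under
conjugation by Pauli operators. -/
theorem rot_rot_conj (u a : PauliLabel n) :
    rot u * (rot u * pauli a * (rot u)ᴴ) * (rot u)ᴴ = comm u a • pauli a := by
  have h : rot u * (rot u * pauli a * (rot u)ᴴ) * (rot u)ᴴ
      = (rot u * rot u) * pauli a * (rot u * rot u)ᴴ := by
    rw [conjTranspose_mul]; simp only [Matrix.mul_assoc]
  rw [h, rot_mul_rot, conjTranspose_neg, pauli_isHermitian, neg_mul, neg_mul_neg,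
    pauli_conj_pauli]

/-- Bilinear forms on matrices that are symmetric, invariant under the rotations `rot u`, and
invariant under multiplication by the swap operator. -/
structure IsCliffordForm₂ (F : Mat n → Mat n → ℂ) : Prop where
  add : ∀ A A' B, F (A + A') B = F A B + F A' B
  smul : ∀ (c : ℂ) A B, F (c • A) B = c * F A B
  symm : ∀ A B, F A B = F B A
  conj : ∀ u A B, F (rot u * A * (rot u)ᴴ) (rot u * B * (rot u)ᴴ) = F A B
  exch : ∀ A B, ∑ v, F (A * pauli v) (B * pauli v) = 2 ^ n * F A B

/-- Quadrilinear forms on matrices that are symmetric, invariant under the rotations `rot u`, and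
invariant under multiplication by the swap operator of two factors. -/
structure IsCliffordForm₄ (F : Mat n → Mat n → Mat n → Mat n → ℂ) : Prop where
  add : ∀ A A' B C D, F (A + A') B C D = F A B C D + F A' B C D
  smul : ∀ (c : ℂ) A B C D, F (c • A) B C D = c * F A B C D
  symm₁₂ : ∀ A B C D, F A B C D = F B A C D
  symm₂₃ : ∀ A B C D, F A B C D = F A C B D
  symm₃₄ : ∀ A B C D, F A B C D = F A B D C
  conj : ∀ u A B C D, F (rot u * A * (rot u)ᴴ) (rot u * B * (rot u)ᴴ) (rot u * C * (rot u)ᴴ)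
    (rot u * D * (rot u)ᴴ) = F A B C D
  exch : ∀ A B C D, ∑ v, F (A * pauli v) (B * pauli v) C D = 2 ^ n * F A B C D

namespace IsCliffordForm₂

variable {F G : Mat n → Mat n → ℂ}

theorem sub (hF : IsCliffordForm₂ F) (hG : IsCliffordForm₂ G) :
    IsCliffordForm₂ fun A B => F A B - G A B where
  add A A' B := by rw [hF.add, hG.add]; ring
  smul c A B := by rw [hF.smul, hG.smul]; ring
  symm A B := by rw [hF.symm, hG.symm]
  conj u A B := by rw [hF.conj, hG.conj]
  exch A B := by rw [Finset.sum_sub_distrib, hF.exch, hG.exch]; ring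

theorem const_mul (hF : IsCliffordForm₂ F) (k : ℂ) : IsCliffordForm₂ fun A B => k * F A B where
  add A A' B := by rw [hF.add]; ring
  smul c A B := by rw [hF.smul]; ring
  symm A B := by rw [hF.symm]
  conj u A B := by rw [hF.conj]
  exch A B := by rw [← Finset.mul_sum, hF.exch]; ring

theorem smul_right (hF : IsCliffordForm₂ F) (c : ℂ) (A B : Mat n) :
    F A (c • B) = c * F A B := by rw [hF.symm, hF.smul, hF.symm]

theorem sum_smul (hF : IsCliffordForm₂ F) {ι : Type*} (s : Finset ι) (c : ι → ℂ) (A : ι → Mat n)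
    (B : Mat n) : F (∑ i ∈ s, c i • A i) B = ∑ i ∈ s, c i * F (A i) B := by
  classical
  induction s using Finset.induction_on with
  | empty => simpa using hF.smul 0 0 B
  | insert i s hi ih => rw [Finset.sum_insert hi, Finset.sum_insert hi, hF.add, hF.smul, ih]

/-- The diagonal values of a Clifford form at Pauli operators. -/
theorem sum_comm_mul (hF : IsCliffordForm₂ F) (c : PauliLabel n) :
    ∑ v, comm c v * F (pauli v) (pauli v) = 2 ^ n * F (pauli c) (pauli c) := by
  -- After the shift v ↦ c + v, the phases of W_c W_v in the two slots multiply to φ² = comm c v,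
  -- which is exactly the weight.
  rw [← hF.exch, ← sum_comm_add c]
  refine Finset.sum_congr rfl fun v _ => ?_
  obtain ⟨φ, h2, hφ⟩ := pauli_mul_sq c v
  rw [hφ, hF.smul, hF.smul_right, comm_add_right, comm_self, one_mul, ← h2]
  ring

/-- The rotation about c + v carries W_c to ±W_v, and the sign occurs twice. -/
theorem pauli_eq_of_anticomm (hF : IsCliffordForm₂ F) {c v : PauliLabel n} (h : comm c v = -1) :
    F (pauli v) (pauli v) = F (pauli c) (pauli c) := by
  have hcu : comm c (c + v) = -1 := by rw [comm_add_right, comm_self, h, one_mul]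
  have hu : pauli (c + v) * pauli c = -(pauli c * pauli (c + v)) := by
    rw [pauli_mul_comm, comm_symm, hcu, neg_one_smul]
  obtain ⟨φ, h2, hφ⟩ := pauli_mul_sq c (c + v)
  rw [← hF.conj (c + v) (pauli c) (pauli c), rot_conj_of_anticomm hu, hφ, label_add_cancel,
    hF.smul, hF.smul, hF.smul_right, hF.smul_right]
  rw [hcu] at h2
  linear_combination (-(Complex.I * Complex.I) * F (pauli v) (pauli v)) * h2
    + F (pauli v) (pauli v) * Complex.I_mul_I

/-- The weight 1 - comm c v keeps only labels anticommuting with c, where the diagonal value is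
constantly x = F(W_c, W_c). The swap identity then reads -d x = d² x. -/
theorem pauli_self (hF : IsCliffordForm₂ F) (h1 : F 1 1 = 0) (c : PauliLabel n) :
    F (pauli c) (pauli c) = 0 := by
  by_cases hc : c = 0
  · rw [hc, pauli_zero, h1]
  have e1 := hF.sum_comm_mul c
  have e0 : ∑ v, F (pauli v) (pauli v) = 0 := by
    simpa [comm_zero_left, pauli_zero, h1] using hF.sum_comm_mul 0
  have e2 : ∑ v, (1 - comm c v) * F (pauli v) (pauli v)
      = ∑ v, (1 - comm c v) * F (pauli c) (pauli c) := by
    refine Finset.sum_congr rfl fun v _ => ?_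
    rcases comm_eq c v with h | h
    · rw [h]; ring
    · rw [hF.pauli_eq_of_anticomm h]
  rw [← Finset.sum_mul, Finset.sum_sub_distrib, sum_comm hc] at e2
  simp only [sub_mul, one_mul, Finset.sum_sub_distrib, e0, e1, Finset.sum_const, Finset.card_univ,
    nsmul_eq_mul, card_label, mul_one, sub_zero] at e2
  have h3 : ((2 : ℂ) ^ n * (2 ^ n + 1)) * F (pauli c) (pauli c) = 0 := by linear_combination -e2
  have h4 : (2 : ℂ) ^ n + 1 ≠ 0 := by exact_mod_cast Nat.succ_ne_zero (2 ^ n)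
  exact (mul_eq_zero.mp h3).resolve_left (mul_ne_zero two_pow_ne_zero h4)

/-- Conjugation by a W_u that anticommutes with W_{a+b} multiplies the value by -1. -/
theorem pauli_ne (hF : IsCliffordForm₂ F) {a b : PauliLabel n} (hab : a ≠ b) :
    F (pauli a) (pauli b) = 0 := by
  obtain ⟨u, hu⟩ := exists_comm_eq_neg_one fun h => hab (label_eq_of_add_eq_zero h)
  have h := (hF.conj u (rot u * pauli a * (rot u)ᴴ) (rot u * pauli b * (rot u)ᴴ)).trans
    (hF.conj u _ _)
  rw [rot_rot_conj, rot_rot_conj, hF.smul, hF.smul_right, ← mul_assoc, ← comm_add_right,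
    hu] at h
  linear_combination (-1 / 2 : ℂ) * h

theorem eq_zero (hF : IsCliffordForm₂ F) (h1 : F 1 1 = 0) (A B : Mat n) : F A B = 0 := by
  have key : ∀ a b : PauliLabel n, F (pauli a) (pauli b) = 0 := by
    intro a b
    by_cases hab : a = b
    · rw [hab, hF.pauli_self h1]
    · exact hF.pauli_ne hab
  have h : ∀ A B : Mat n, (∀ a, F (pauli a) B = 0) → F A B = 0 := by
    intro A B hB
    have := hF.sum_smul Finset.univ (fun a => trace (A * pauli a)) pauli B
    rw [sum_trace_smul_pauli, hF.smul] at this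
    simp only [hB, mul_zero, Finset.sum_const_zero] at this
    exact (mul_eq_zero.mp this).resolve_left two_pow_ne_zero
  refine h A B fun a => ?_
  rw [hF.symm]
  exact h B _ fun b => key b a

end IsCliffordForm₂

/-! ### Sums of products of commutation signs -/

theorem sum_comm_mul_comm {a b : PauliLabel n} (hab : a ≠ b) :
    ∑ v, comm a v * comm b v = 0 := by
  simp only [← comm_add_left]
  exact sum_comm fun h => hab (label_eq_of_add_eq_zero h)

theorem sum_one_label : ∑ _v : PauliLabel n, (1 : ℂ) = (2 ^ n) ^ 2 := by
  rw [Finset.sum_const, Finset.card_univ, nsmul_eq_mul, card_label, mul_one]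

theorem sum_sub_mul_sub {a b : PauliLabel n} (ha : a ≠ 0) (hb : b ≠ 0) (hab : a ≠ b) :
    ∑ v, (1 - comm a v) * (1 - comm b v) = (2 ^ n) ^ 2 := by
  have h : ∀ v, (1 - comm a v) * (1 - comm b v)
      = 1 - comm a v - comm b v + comm a v * comm b v := fun v => by ring
  simp only [h, Finset.sum_add_distrib, Finset.sum_sub_distrib, sum_comm ha, sum_comm hb,
    sum_comm_mul_comm hab, sum_one_label]
  ring

theorem sum_sub_mul_add {a b : PauliLabel n} (ha : a ≠ 0) (hb : b ≠ 0) (hab : a ≠ b) :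
    ∑ v, (1 - comm a v) * (1 + comm b v) = (2 ^ n) ^ 2 := by
  have h : ∀ v, (1 - comm a v) * (1 + comm b v)
      = 1 - comm a v + comm b v - comm a v * comm b v := fun v => by ring
  simp only [h, Finset.sum_add_distrib, Finset.sum_sub_distrib, sum_comm ha, sum_comm hb,
    sum_comm_mul_comm hab, sum_one_label]
  ring

/-- The hypotheses say that a, b, c are linearly independent over 𝔽₂, so of the eight characters in
the expanded product only the trivial one has nonzero sum. The weight counts, eight times each, the
labels with signs -1, -1, 1. -/
theorem sum_sub_mul_sub_mul_add {a b c : PauliLabel n} (ha : a ≠ 0) (hb : b ≠ 0) (hc : c ≠ 0)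
    (hab : a ≠ b) (hac : a ≠ c) (hbc : b ≠ c) (habc : a + b ≠ c) :
    ∑ v, (1 - comm a v) * (1 - comm b v) * (1 + comm c v) = (2 ^ n) ^ 2 := by
  have h : ∀ v, (1 - comm a v) * (1 - comm b v) * (1 + comm c v)
      = 1 - comm a v - comm b v + comm c v + comm a v * comm b v - comm a v * comm c v
        - comm b v * comm c v + comm (a + b) v * comm c v := fun v => by
    rw [comm_add_left]; ring
  simp only [h, Finset.sum_add_distrib, Finset.sum_sub_distrib, sum_comm ha, sum_comm hb,
    sum_comm hc, sum_comm_mul_comm hab, sum_comm_mul_comm hac, sum_comm_mul_comm hbc,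
    sum_comm_mul_comm habc, sum_one_label]
  ring

theorem exists_comm_eq_neg_one₂ {a b : PauliLabel n} (ha : a ≠ 0) (hb : b ≠ 0) :
    ∃ w, comm a w = -1 ∧ comm b w = -1 := by
  by_cases hab : a = b
  · obtain ⟨w, hw⟩ := exists_comm_eq_neg_one ha
    rw [comm_symm] at hw
    exact ⟨w, hw, hab ▸ hw⟩
  by_contra! h
  have h0 : ∑ v, (1 - comm a v) * (1 - comm b v) = 0 := by
    refine Finset.sum_eq_zero fun v _ => ?_
    rcases comm_eq a v with h1 | h1
    · rw [h1]; ring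
    · rw [(comm_eq b v).resolve_right (h v h1)]; ring
  rw [sum_sub_mul_sub ha hb hab] at h0
  exact pow_ne_zero 2 two_pow_ne_zero h0

theorem pauli_comm_of {a b : PauliLabel n} (h : comm a b = 1) :
    pauli a * pauli b = pauli b * pauli a := by
  rw [pauli_mul_comm, h, one_smul]

theorem pauli_anticomm_of {a b : PauliLabel n} (h : comm a b = -1) :
    pauli a * pauli b = -(pauli b * pauli a) := by
  rw [pauli_mul_comm, h, neg_one_smul]

/-! ### Elementary relations for invariant quadrilinear forms -/

namespace IsCliffordForm₄

variable {F G : Mat n → Mat n → Mat n → Mat n → ℂ}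

theorem sub (hF : IsCliffordForm₄ F) (hG : IsCliffordForm₄ G) :
    IsCliffordForm₄ fun A B C D => F A B C D - G A B C D where
  add A A' B C D := by rw [hF.add, hG.add]; ring
  smul c A B C D := by rw [hF.smul, hG.smul]; ring
  symm₁₂ A B C D := by rw [hF.symm₁₂, hG.symm₁₂]
  symm₂₃ A B C D := by rw [hF.symm₂₃, hG.symm₂₃]
  symm₃₄ A B C D := by rw [hF.symm₃₄, hG.symm₃₄]
  conj u A B C D := by rw [hF.conj, hG.conj]
  exch A B C D := by rw [Finset.sum_sub_distrib, hF.exch, hG.exch]; ring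

theorem const_mul (hF : IsCliffordForm₄ F) (k : ℂ) :
    IsCliffordForm₄ fun A B C D => k * F A B C D where
  add A A' B C D := by rw [hF.add]; ring
  smul c A B C D := by rw [hF.smul]; ring
  symm₁₂ A B C D := by rw [hF.symm₁₂]
  symm₂₃ A B C D := by rw [hF.symm₂₃]
  symm₃₄ A B C D := by rw [hF.symm₃₄]
  conj u A B C D := by rw [hF.conj]
  exch A B C D := by rw [← Finset.mul_sum, hF.exch]; ring

variable (hF : IsCliffordForm₄ F)
include hF

theorem smul₂ (c : ℂ) (A B C D : Mat n) : F A (c • B) C D = c * F A B C D := by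
  rw [hF.symm₁₂, hF.smul, hF.symm₁₂]

theorem smul₃ (c : ℂ) (A B C D : Mat n) : F A B (c • C) D = c * F A B C D := by
  rw [hF.symm₂₃, hF.smul₂, hF.symm₂₃]

theorem smul₄ (c : ℂ) (A B C D : Mat n) : F A B C (c • D) = c * F A B C D := by
  rw [hF.symm₃₄, hF.smul₃, hF.symm₃₄]

theorem symm_pairs (A B C D : Mat n) : F A B C D = F C D A B := by
  rw [hF.symm₂₃, hF.symm₁₂, hF.symm₃₄, hF.symm₂₃]

theorem symm₁₄ (A B C D : Mat n) : F A B C D = F D B C A := by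
  rw [hF.symm_pairs, hF.symm₁₂, hF.symm₂₃, hF.symm₃₄, hF.symm₂₃, hF.symm₃₄]

/-- This lets the bilinear uniqueness theorem settle every value with two identity arguments. -/
theorem slice : IsCliffordForm₂ fun A B => F A B 1 1 where
  add A A' B := hF.add ..
  smul c A B := hF.smul ..
  symm A B := hF.symm₁₂ ..
  conj u A B := by
    have h : rot u * 1 * (rot u)ᴴ = 1 := rot_conj_of_comm (by simp)
    have := hF.conj u A B 1 1
    rwa [h] at this
  exch A B := hF.exch ..

theorem sum_smul {ι : Type*} (s : Finset ι) (c : ι → ℂ) (A : ι → Mat n)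
    (B C D : Mat n) : F (∑ i ∈ s, c i • A i) B C D = ∑ i ∈ s, c i * F (A i) B C D := by
  classical
  induction s using Finset.induction_on with
  | empty => simpa using hF.smul 0 0 B C D
  | insert i s hi ih => rw [Finset.sum_insert hi, Finset.sum_insert hi, hF.add, hF.smul, ih]

theorem sum_comm_mul (c : PauliLabel n) (A B C D : Mat n) :
    ∑ v, comm c v * F (A * pauli v) (B * pauli v) C D
      = 2 ^ n * F (A * pauli c) (B * pauli c) C D := by
  rw [← hF.exch, ← sum_comm_add c]
  refine Finset.sum_congr rfl fun v _ => ?_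
  obtain ⟨φ, h2, hφ⟩ := pauli_mul_sq c v
  rw [Matrix.mul_assoc, Matrix.mul_assoc, hφ, Matrix.mul_smul, Matrix.mul_smul, hF.smul, hF.smul₂,
    comm_add_right, comm_self, one_mul, ← h2]
  ring

/-- Invariance under a rotation that anticommutes with the first two arguments and commutes with
the other two. -/
theorem mul_pauli (u : PauliLabel n) {A B C D : Mat n}
    (hA : pauli u * A = -(A * pauli u)) (hB : pauli u * B = -(B * pauli u))
    (hC : pauli u * C = C * pauli u) (hD : pauli u * D = D * pauli u) :
    F (A * pauli u) (B * pauli u) C D = -F A B C D := by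
  rw [← hF.conj u A B C D, rot_conj_of_anticomm hA, rot_conj_of_anticomm hB, rot_conj_of_comm hC,
    rot_conj_of_comm hD, hF.smul, hF.smul₂]
  linear_combination F (A * pauli u) (B * pauli u) C D * Complex.I_mul_I

theorem exists_shift (a b v : PauliLabel n) (C D : Mat n) :
    ∃ φ, F (pauli a * pauli v) (pauli b * pauli v) C D
      = φ * F (pauli (a + v)) (pauli (b + v)) C D := by
  obtain ⟨c, -, hc⟩ := pauli_mul a v
  obtain ⟨c', -, hc'⟩ := pauli_mul b v
  refine ⟨c * c', ?_⟩
  rw [hc, hc', hF.smul, hF.smul₂, mul_assoc]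

theorem shift_eq_zero {a b v : PauliLabel n} {C D : Mat n}
    (h : F (pauli (a + v)) (pauli (b + v)) C D = 0) :
    F (pauli a * pauli v) (pauli b * pauli v) C D = 0 := by
  obtain ⟨φ, hφ⟩ := hF.exists_shift a b v C D
  rw [hφ, h, mul_zero]

/-- The rotation about a + b fixes W_c and W_e and exchanges W_a and W_b up to phases whose product
is -1. Symmetry of the form then gives F = -F. -/
theorem mixed {a b c e : PauliLabel n} (hab : comm a b = -1) (hc : comm a c = comm b c)
    (he : comm a e = comm b e) : F (pauli a) (pauli b) (pauli c) (pauli e) = 0 := by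
  have hua : pauli (a + b) * pauli a = -(pauli a * pauli (a + b)) :=
    pauli_anticomm_of (by rw [comm_add_left, comm_self, comm_symm b, hab, one_mul])
  have hub : pauli (a + b) * pauli b = -(pauli b * pauli (a + b)) :=
    pauli_anticomm_of (by rw [comm_add_left, comm_self, hab, mul_one])
  have huc : pauli (a + b) * pauli c = pauli c * pauli (a + b) :=
    pauli_comm_of (by rw [comm_add_left, hc, comm_sq])
  have hue : pauli (a + b) * pauli e = pauli e * pauli (a + b) :=
    pauli_comm_of (by rw [comm_add_left, he, comm_sq])
  have h := hF.mul_pauli (a + b) hua hub huc hue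
  obtain ⟨φ, h2, hφ⟩ := pauli_mul_sq a b
  have h3 : pauli (a + b) = φ⁻¹ • (pauli a * pauli b) := by
    rw [hφ, smul_smul, inv_mul_cancel₀, one_smul]
    rintro rfl
    rw [hab] at h2
    norm_num at h2
  have h4 : pauli a * pauli (a + b) = φ⁻¹ • pauli b := by
    rw [h3, Matrix.mul_smul, ← Matrix.mul_assoc, pauli_mul_self, Matrix.one_mul]
  have h5 : pauli b * pauli (a + b) = (-φ⁻¹) • pauli a := by
    rw [h3, Matrix.mul_smul, ← Matrix.mul_assoc, pauli_conj_pauli, comm_symm, hab, smul_smul,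
      mul_neg_one]
  have h6 : φ⁻¹ * φ⁻¹ = -1 := by rw [← mul_inv, h2, hab]; norm_num
  rw [h4, h5, hF.smul, hF.smul₂, hF.symm₁₂] at h
  linear_combination (1 / 2 : ℂ) * h + (1 / 2 : ℂ) * F (pauli a) (pauli b) (pauli c) (pauli e) * h6

theorem eq_zero_of_sum_ne_zero {a b c e : PauliLabel n} (h : a + b + c + e ≠ 0) :
    F (pauli a) (pauli b) (pauli c) (pauli e) = 0 := by
  obtain ⟨u, hu⟩ := exists_comm_eq_neg_one h
  have h := (hF.conj u (rot u * pauli a * (rot u)ᴴ) (rot u * pauli b * (rot u)ᴴ)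
    (rot u * pauli c * (rot u)ᴴ) (rot u * pauli e * (rot u)ᴴ)).trans (hF.conj u _ _ _ _)
  simp only [comm_add_right] at hu
  rw [rot_rot_conj, rot_rot_conj, rot_rot_conj, rot_rot_conj, hF.smul, hF.smul₂, hF.smul₃,
    hF.smul₄] at h
  linear_combination (-1 / 2 : ℂ) * h
    + (1 / 2 : ℂ) * F (pauli a) (pauli b) (pauli c) (pauli e) * hu

/-- The rotation about c + v carries W_c to ±W_v and, by `ha`, fixes W_a; the sign occurs twice. -/
theorem pairs_shift {a c v : PauliLabel n} (hcv : comm c v = -1) (ha : comm a c = comm a v) :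
    F (pauli a) (pauli a) (pauli v) (pauli v) = F (pauli a) (pauli a) (pauli c) (pauli c) := by
  have hcu : comm c (c + v) = -1 := by rw [comm_add_right, comm_self, hcv, one_mul]
  have h1 : pauli (c + v) * pauli c = -(pauli c * pauli (c + v)) :=
    pauli_anticomm_of (by rw [comm_symm, hcu])
  have h2 : pauli (c + v) * pauli a = pauli a * pauli (c + v) :=
    pauli_comm_of (by rw [comm_symm, comm_add_right, ha, comm_sq])
  have h := hF.mul_pauli (c + v) h1 h1 h2 h2
  obtain ⟨φ, hφ2, hφ⟩ := pauli_mul_sq c (c + v)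
  rw [hφ, label_add_cancel, hF.smul, hF.smul₂, hF.symm_pairs, hF.symm_pairs (pauli c)] at h
  rw [hcu] at hφ2
  linear_combination -h + F (pauli a) (pauli a) (pauli v) (pauli v) * hφ2

theorem diag_shift {c v : PauliLabel n} (hcv : comm c v = -1) :
    F (pauli v) (pauli v) (pauli v) (pauli v) = F (pauli c) (pauli c) (pauli c) (pauli c) := by
  have hcu : comm c (c + v) = -1 := by rw [comm_add_right, comm_self, hcv, one_mul]
  have h1 : pauli (c + v) * pauli c = -(pauli c * pauli (c + v)) :=
    pauli_anticomm_of (by rw [comm_symm, hcu])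
  obtain ⟨φ, hφ2, hφ⟩ := pauli_mul_sq c (c + v)
  have h := hF.conj (c + v) (pauli c) (pauli c) (pauli c) (pauli c)
  rw [rot_conj_of_anticomm h1, hφ, label_add_cancel, smul_smul, hF.smul, hF.smul₂, hF.smul₃,
    hF.smul₄] at h
  rw [hcu] at hφ2
  have h3 : -Complex.I * φ * (-Complex.I * φ) = 1 := by
    linear_combination (Complex.I * Complex.I) * hφ2 - Complex.I_mul_I
  linear_combination h - F (pauli v) (pauli v) (pauli v) (pauli v) *
    (-Complex.I * φ * (-Complex.I * φ) + 1) * h3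

end IsCliffordForm₄

theorem two_pow_add_one_ne_zero : (2 : ℂ) ^ n + 1 ≠ 0 := by
  exact_mod_cast Nat.succ_ne_zero (2 ^ n)

/-! ### Vanishing of an invariant quadrilinear form on all Pauli quadruples -/

namespace IsCliffordForm₄

variable {F : Mat n → Mat n → Mat n → Mat n → ℂ} (hF : IsCliffordForm₄ F)
include hF

/-- Any two nonzero labels have a common anticommuting label, so two rotations identify their
diagonal values. The sum hypothesis becomes (d² - 1) x = 0. -/
theorem pauli_diag (h1 : F 1 1 1 1 = 0)
    (hs : ∑ v, F (pauli v) (pauli v) (pauli v) (pauli v) = 0) (a : PauliLabel n) :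
    F (pauli a) (pauli a) (pauli a) (pauli a) = 0 := by
  by_cases ha : a = 0
  · rw [ha, pauli_zero, h1]
  have key : ∀ v, F (pauli v) (pauli v) (pauli v) (pauli v)
      = if v = 0 then 0 else F (pauli a) (pauli a) (pauli a) (pauli a) := by
    intro v
    split_ifs with hv
    · rw [hv, pauli_zero, h1]
    · obtain ⟨w, hw, hw'⟩ := exists_comm_eq_neg_one₂ ha hv
      rw [← hF.diag_shift hw, hF.diag_shift hw']
  rw [Finset.sum_congr rfl fun v _ => key v] at hs
  have h2 : ∀ v : PauliLabel n, (if v = 0 then 0 else F (pauli a) (pauli a) (pauli a) (pauli a))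
      = F (pauli a) (pauli a) (pauli a) (pauli a)
        - if v = 0 then F (pauli a) (pauli a) (pauli a) (pauli a) else 0 := by
    intro v; split_ifs <;> simp
  rw [Finset.sum_congr rfl fun v _ => h2 v, Finset.sum_sub_distrib, Finset.sum_const,
    Finset.card_univ, nsmul_eq_mul, card_label, Finset.sum_ite_eq', if_pos (Finset.mem_univ _)] at hs
  have hn : n ≠ 0 := by
    rintro rfl
    exact ha (Subsingleton.elim _ _)
  have h3 : (2 : ℂ) ^ n - 1 ≠ 0 := by
    rw [sub_ne_zero]
    exact_mod_cast (Nat.one_lt_two_pow hn).ne'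
  have h4 : (((2 : ℂ) ^ n - 1) * (2 ^ n + 1)) * F (pauli a) (pauli a) (pauli a) (pauli a) = 0 := by
    linear_combination hs
  exact (mul_eq_zero.mp h4).resolve_left (mul_ne_zero h3 two_pow_add_one_ne_zero)

/-- The value F(W_a, W_a, W_v, W_v) is the same for all v anticommuting with a. The weight 1 - comm
a v isolates these v, and the swap identity makes their weighted sum -d F(W_a, W_a, W_a, W_a) = 0.
-/
theorem pairs_anticomm (h1 : F 1 1 1 1 = 0)
    (hs : ∑ v, F (pauli v) (pauli v) (pauli v) (pauli v) = 0) {a c : PauliLabel n}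
    (hac : comm a c = -1) : F (pauli a) (pauli a) (pauli c) (pauli c) = 0 := by
  have ha : a ≠ 0 := by
    rintro rfl
    rw [comm_zero_left] at hac
    norm_num at hac
  have e0 : ∑ v, F (pauli v) (pauli v) (pauli a) (pauli a) = 0 := by
    have := hF.exch 1 1 (pauli a) (pauli a)
    rw [hF.symm_pairs 1 1, hF.slice.eq_zero h1] at this
    simpa using this
  have e1 : ∑ v, comm a v * F (pauli v) (pauli v) (pauli a) (pauli a) = 0 := by
    have := hF.sum_comm_mul a 1 1 (pauli a) (pauli a)
    simp only [Matrix.one_mul] at this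
    rw [this, hF.pauli_diag h1 hs, mul_zero]
  have e2 : ∑ v, (1 - comm a v) * F (pauli v) (pauli v) (pauli a) (pauli a)
      = ∑ v, (1 - comm a v) * F (pauli a) (pauli a) (pauli c) (pauli c) := by
    refine Finset.sum_congr rfl fun v _ => ?_
    rcases comm_eq a v with h | h
    · rw [h]; ring
    · congr 1
      rw [hF.symm_pairs]
      rcases comm_eq c v with hcv | hcv
      -- When c and v commute, no single rotation links them; v + a anticommutes with both and
      -- serves as intermediate label.
      · have h3 : comm a (v + a) = -1 := by rw [comm_add_right, h, comm_self, mul_one]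
        rw [hF.pairs_shift (c := v + a) (v := v), hF.pairs_shift (c := c) (v := v + a)]
        · rw [comm_add_right, hcv, comm_symm, hac, one_mul]
        · rw [hac, h3]
        · rw [comm_add_left, comm_self, h, one_mul]
        · rw [h3, h]
      · exact hF.pairs_shift hcv (hac.trans h.symm)
  simp only [← Finset.sum_mul, Finset.sum_sub_distrib, sum_comm ha, sum_one_label] at e2
  simp only [sub_mul, one_mul, Finset.sum_sub_distrib, e0, e1] at e2
  have h3 : ((2 : ℂ) ^ n) ^ 2 * F (pauli a) (pauli a) (pauli c) (pauli c) = 0 := by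
    linear_combination -e2
  exact (mul_eq_zero.mp h3).resolve_left (pow_ne_zero 2 two_pow_ne_zero)

/-- In the remaining case a and c commute and are distinct and nonzero. Among labels v anticommuting
with c, those anticommuting with a contribute nothing and the others all give x = F(W_a, W_a, W_c,
W_c), whence -d x = d² x / 2. -/
theorem pairs (h1 : F 1 1 1 1 = 0)
    (hs : ∑ v, F (pauli v) (pauli v) (pauli v) (pauli v) = 0) (a c : PauliLabel n) :
    F (pauli a) (pauli a) (pauli c) (pauli c) = 0 := by
  rcases comm_eq a c with hac | hac
  swap
  · exact hF.pairs_anticomm h1 hs hac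
  by_cases ha : a = 0
  · rw [ha, pauli_zero, hF.symm_pairs, hF.slice.eq_zero h1]
  by_cases hc : c = 0
  · rw [hc, pauli_zero, hF.slice.eq_zero h1]
  by_cases hne : c = a
  · rw [hne, hF.pauli_diag h1 hs]
  have e0 : ∑ v, F (pauli v) (pauli v) (pauli a) (pauli a) = 0 := by
    have := hF.exch 1 1 (pauli a) (pauli a)
    rw [hF.symm_pairs 1 1, hF.slice.eq_zero h1] at this
    simpa using this
  have e1 : ∑ v, comm c v * F (pauli v) (pauli v) (pauli a) (pauli a)
      = 2 ^ n * F (pauli a) (pauli a) (pauli c) (pauli c) := by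
    have := hF.sum_comm_mul c 1 1 (pauli a) (pauli a)
    simp only [Matrix.one_mul] at this
    rw [this, hF.symm_pairs]
  have e2 : ∑ v, (1 - comm c v) * F (pauli v) (pauli v) (pauli a) (pauli a)
      = ∑ v, (1 - comm c v) * (1 + comm a v) *
        (F (pauli a) (pauli a) (pauli c) (pauli c) / 2) := by
    refine Finset.sum_congr rfl fun v _ => ?_
    rw [hF.symm_pairs]
    rcases comm_eq a v with h | h
    · rcases comm_eq c v with h' | h'
      · rw [h']; ring
      · rw [hF.pairs_shift h' (hac.trans h.symm), h]; ring
    · rw [hF.pairs_anticomm h1 hs h, h]; ring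
  rw [← Finset.sum_mul, sum_sub_mul_add hc ha hne] at e2
  simp only [sub_mul, one_mul, Finset.sum_sub_distrib, e0, e1] at e2
  have h3 : (2 : ℂ) ^ n * (2 ^ n + 2) * F (pauli a) (pauli a) (pauli c) (pauli c) = 0 := by
    linear_combination -2 * e2
  have h4 : (2 : ℂ) ^ n + 2 ≠ 0 := by exact_mod_cast Nat.succ_ne_zero (2 ^ n + 1)
  exact (mul_eq_zero.mp h3).resolve_left (mul_ne_zero two_pow_ne_zero h4)

/-- Apply the swap identity to the first two slots, over v anticommuting with b. If v commutes with
c, the shifted pair anticommutes and `mixed` kills the term; otherwise a rotation about v returns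
-x. This gives d x = -d² x / 2. -/
theorem with_one (h1 : F 1 1 1 1 = 0) {b c : PauliLabel n} (hbc : comm b c = 1) :
    F (pauli b) (pauli c) 1 (pauli (b + c)) = 0 := by
  have hsl := hF.slice.eq_zero h1
  by_cases hb : b = 0
  · rw [hb, pauli_zero, hF.symm₂₃, hF.symm_pairs, hsl]
  by_cases hc : c = 0
  · rw [hc, pauli_zero, hF.symm₃₄, hF.symm₂₃, hsl]
  by_cases hne : b = c
  · rw [hne, label_add_self, pauli_zero, hsl]
  set D := pauli (b + c) with hD
  have e0 := hF.exch (pauli b) (pauli c) 1 D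
  have e1 : ∑ v, comm b v * F (pauli b * pauli v) (pauli c * pauli v) 1 D = 0 := by
    obtain ⟨φ, -, hφ⟩ := pauli_mul c b
    rw [hF.sum_comm_mul, pauli_mul_self, hφ, hF.smul₂, hF.symm₂₃, hF.symm_pairs, hsl]
    ring
  have e2 : ∑ v, (1 - comm b v) * F (pauli b * pauli v) (pauli c * pauli v) 1 D
      = ∑ v, (1 - comm b v) * (1 - comm c v) * (-F (pauli b) (pauli c) 1 D / 2) := by
    refine Finset.sum_congr rfl fun v _ => ?_
    rcases comm_eq b v with h | h
    · rw [h]; ring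
    rcases comm_eq c v with h' | h'
    · rw [hF.shift_eq_zero, h']
      · ring
      · rw [← pauli_zero]
        refine hF.mixed ?_ ?_ ?_
        · rw [comm_add_left, comm_add_right, comm_add_right, hbc, h, comm_self, comm_symm v, h']
          norm_num
        · rw [comm_zero_right, comm_zero_right]
        · simp only [comm_add_left, comm_add_right, comm_self, hbc, comm_symm c b]
    · rw [hF.mul_pauli v, h, h']
      · ring
      · exact pauli_anticomm_of (by rw [comm_symm, h])
      · exact pauli_anticomm_of (by rw [comm_symm, h'])
      · simp
      · exact pauli_comm_of (by rw [comm_add_right, comm_symm, h, comm_symm, h']; norm_num)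
  rw [← Finset.sum_mul, sum_sub_mul_sub hb hc hne] at e2
  simp only [sub_mul, one_mul, Finset.sum_sub_distrib, e0, e1] at e2
  have h3 : (2 : ℂ) ^ n * (2 ^ n + 2) * F (pauli b) (pauli c) 1 D = 0 := by
    linear_combination 2 * e2
  have h4 : (2 : ℂ) ^ n + 2 ≠ 0 := by exact_mod_cast Nat.succ_ne_zero (2 ^ n + 1)
  exact (mul_eq_zero.mp h3).resolve_left (mul_ne_zero two_pow_ne_zero h4)

/-- The exchange relation for four commuting Pauli operators with product proportional to one. -/
theorem commuting_relation (h1 : F 1 1 1 1 = 0)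
    (hs : ∑ v, F (pauli v) (pauli v) (pauli v) (pauli v) = 0) {a b c : PauliLabel n}
    (ha : a ≠ 0) (hb : b ≠ 0) (hc : c ≠ 0) (hab : a ≠ b) (hac : a ≠ c) (hbc : b ≠ c)
    (habc : a + b ≠ c) (kab : comm a b = 1) (kac : comm a c = 1) (kbc : comm b c = 1) :
    F (pauli a * pauli c) (pauli b * pauli c) (pauli c) (pauli (a + b + c))
      = -(1 + 2 ^ n / 2) * F (pauli a) (pauli b) (pauli c) (pauli (a + b + c)) := by
  set C := pauli c with hC
  set D := pauli (a + b + c) with hD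
  have e0 := hF.exch (pauli a) (pauli b) C D
  have e1 : ∑ v, comm a v * F (pauli a * pauli v) (pauli b * pauli v) C D = 0 := by
    obtain ⟨φ, -, hφ⟩ := pauli_mul b a
    have h : F (pauli c) (pauli (b + a)) 1 (pauli (c + (b + a))) = 0 :=
      hF.with_one h1 (by rw [comm_add_right, comm_symm, kbc, comm_symm, kac, one_mul])
    have h' : c + (b + a) = a + b + c := by abel
    rw [h'] at h
    rw [hF.sum_comm_mul, pauli_mul_self, hφ, hF.smul₂, hF.symm₂₃, hF.symm₁₂, hF.symm₂₃, h]
    ring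
  have e2 := hF.sum_comm_mul c (pauli a) (pauli b) C D
  have e3 : ∑ v, comm (a + c) v * F (pauli a * pauli v) (pauli b * pauli v) C D = 0 := by
    have h : b + (a + c) = a + b + c := by abel
    rw [hF.sum_comm_mul, hF.shift_eq_zero, mul_zero]
    rw [label_add_cancel, h, hF.symm₂₃, hF.pairs h1 hs]
  -- The weight keeps v anticommuting with a and commuting with c. Such terms vanish by `mixed` if v
  -- commutes with b, and equal minus the original value by rotation about v if not.
  have e4 : ∑ v, (1 - comm a v) * (1 + comm c v) * F (pauli a * pauli v) (pauli b * pauli v) C D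
      = ∑ v, (1 - comm a v) * (1 - comm b v) * (1 + comm c v)
        * (-F (pauli a) (pauli b) C D / 2) := by
    refine Finset.sum_congr rfl fun v _ => ?_
    rcases comm_eq a v with h | h
    · rw [h]; ring
    rcases comm_eq c v with hv | hv
    swap
    · rw [hv]; ring
    rcases comm_eq b v with h' | h'
    · rw [hF.shift_eq_zero, h']
      · ring
      · refine hF.mixed ?_ ?_ ?_
        · rw [comm_add_left, comm_add_right, comm_add_right, kab, h, comm_self, comm_symm v, h']
          norm_num
        · rw [comm_add_left, comm_add_left, kac, kbc]
        · simp only [comm_add_left, comm_add_right, comm_self, kab, kac, kbc, comm_symm b a]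
    · rw [hF.mul_pauli v, h, h']
      · ring
      · exact pauli_anticomm_of (by rw [comm_symm, h])
      · exact pauli_anticomm_of (by rw [comm_symm, h'])
      · exact pauli_comm_of (by rw [comm_symm, hv])
      · refine pauli_comm_of ?_
        rw [comm_add_right, comm_add_right, comm_symm, h, comm_symm, h', comm_symm, hv]
        norm_num
  rw [← Finset.sum_mul, sum_sub_mul_sub_mul_add ha hb hc hab hac hbc habc] at e4
  have h5 : ∀ v, (1 - comm a v) * (1 + comm c v) * F (pauli a * pauli v) (pauli b * pauli v) C D
      = F (pauli a * pauli v) (pauli b * pauli v) C D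
        - comm a v * F (pauli a * pauli v) (pauli b * pauli v) C D
        + comm c v * F (pauli a * pauli v) (pauli b * pauli v) C D
        - comm (a + c) v * F (pauli a * pauli v) (pauli b * pauli v) C D := fun v => by
    rw [comm_add_left]; ring
  simp only [h5, Finset.sum_sub_distrib, Finset.sum_add_distrib, e0, e1, e2, e3] at e4
  refine mul_left_cancel₀ (two_pow_ne_zero (n := n)) ?_
  linear_combination e4

/-- `commuting_relation` turns (a, b) into (a + c, b + c) at the cost of a factor -(1 + d/2). Doing
so twice returns to the start with all phases cancelling, so the value is fixed by multiplication by
(1 + d/2)² ≠ 1. -/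
theorem commuting (h1 : F 1 1 1 1 = 0)
    (hs : ∑ v, F (pauli v) (pauli v) (pauli v) (pauli v) = 0) {a b c : PauliLabel n}
    (kab : comm a b = 1) (kac : comm a c = 1) (kbc : comm b c = 1) :
    F (pauli a) (pauli b) (pauli c) (pauli (a + b + c)) = 0 := by
  have hone : ∀ {x y : PauliLabel n}, comm x y = 1 → F (pauli x) (pauli y) 1 (pauli (x + y)) = 0 :=
    fun h => hF.with_one h1 h
  by_cases ha : a = 0
  · rw [ha, pauli_zero, zero_add, hF.symm₁₂, hF.symm₂₃, hone kbc]
  by_cases hb : b = 0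
  · rw [hb, pauli_zero, add_zero, hF.symm₂₃, hone kac]
  by_cases hc : c = 0
  · rw [hc, pauli_zero, add_zero, hone kab]
  by_cases hab : a = b
  · rw [hab, label_add_self, zero_add, hF.pairs h1 hs]
  by_cases hbc : b = c
  · rw [hbc, label_add_cancel', hF.symm₃₄, hF.symm₂₃, hF.pairs h1 hs]
  by_cases hac : a = c
  · rw [hac, add_comm c b, label_add_cancel', hF.symm₂₃, hF.pairs h1 hs]
  by_cases habc : a + b = c
  · rw [habc, label_add_self, pauli_zero, hF.symm₃₄, ← habc, hone kab]
  have r1 := hF.commuting_relation h1 hs ha hb hc hab hac hbc habc kab kac kbc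
  have r2 := hF.commuting_relation h1 hs (a := a + c) (b := b + c) (c := c)
    (fun h => hac (label_eq_of_add_eq_zero h)) (fun h => hbc (label_eq_of_add_eq_zero h)) hc
    (fun h => hab (add_right_cancel h)) (fun h => ha (by simpa using h))
    (fun h => hb (by simpa using h))
    (fun h => habc (by
      rw [add_add_add_comm, label_add_self, add_zero] at h
      exact h))
    (by simp only [comm_add_left, comm_add_right, comm_self, kab, kac, comm_symm c b, kbc]; ring)
    (by rw [comm_add_left, comm_self, kac, one_mul]) (by rw [comm_add_left, comm_self, kbc, one_mul])
  have hsum : a + c + (b + c) + c = a + b + c := by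
    rw [add_add_add_comm, label_add_self, add_zero]
  rw [hsum] at r2
  obtain ⟨φ, hφ2, hφ⟩ := pauli_mul_sq a c
  obtain ⟨ψ, hψ2, hψ⟩ := pauli_mul_sq b c
  rw [hφ, hψ, hF.smul, hF.smul₂] at r1
  obtain ⟨φ', hφ2', hφ'⟩ := pauli_mul_sq (a + c) c
  obtain ⟨ψ', hψ2', hψ'⟩ := pauli_mul_sq (b + c) c
  rw [hφ', hψ', hF.smul, hF.smul₂, label_add_cancel', label_add_cancel'] at r2
  have hp : φ * φ' = 1 := by
    have h : pauli a * pauli c * pauli c = pauli a := by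
      rw [Matrix.mul_assoc, pauli_mul_self, Matrix.mul_one]
    rw [hφ, Matrix.smul_mul, hφ', label_add_cancel', smul_smul] at h
    have h' := congrArg (fun M => trace (M * pauli a)) h
    simp only [Matrix.smul_mul, pauli_mul_self, trace_smul, trace_one_mat, smul_eq_mul] at h'
    exact mul_right_cancel₀ two_pow_ne_zero (h'.trans (one_mul _).symm)
  have hq : ψ * ψ' = 1 := by
    have h : pauli b * pauli c * pauli c = pauli b := by
      rw [Matrix.mul_assoc, pauli_mul_self, Matrix.mul_one]
    rw [hψ, Matrix.smul_mul, hψ', label_add_cancel', smul_smul] at h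
    have h' := congrArg (fun M => trace (M * pauli b)) h
    simp only [Matrix.smul_mul, pauli_mul_self, trace_smul, trace_one_mat, smul_eq_mul] at h'
    exact mul_right_cancel₀ two_pow_ne_zero (h'.trans (one_mul _).symm)
  set T := F (pauli a) (pauli b) (pauli c) (pauli (a + b + c))
  set T' := F (pauli (a + c)) (pauli (b + c)) (pauli c) (pauli (a + b + c))
  have h3 : (2 : ℂ) ^ n * (2 ^ n + 4) * T = 0 := by
    linear_combination (4 * (1 + 2 ^ n / 2)) * r1 - 4 * φ * ψ * r2 + 4 * ψ * ψ' * T * hp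
      + 4 * T * hq
  have h4 : (2 : ℂ) ^ n + 4 ≠ 0 := by exact_mod_cast Nat.succ_ne_zero (2 ^ n + 3)
  exact (mul_eq_zero.mp h3).resolve_left (mul_ne_zero two_pow_ne_zero h4)

/-- For v anticommuting with c, the labels a + v and b + v commute with c, so each shifted quadruple
falls under `commuting` or `mixed`. The weighted swap identity thus has right side 0, while its left
side is 2d times the value. -/
theorem cross (h1 : F 1 1 1 1 = 0)
    (hs : ∑ v, F (pauli v) (pauli v) (pauli v) (pauli v) = 0) {a b c e : PauliLabel n}
    (hsum : a + b + c = e) (kab : comm a b = 1) (kac : comm a c = -1) (kbc : comm b c = -1) :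
    F (pauli a) (pauli b) (pauli c) (pauli e) = 0 := by
  have hc : comm a b * comm a e = -1 := by
    rw [← hsum, comm_add_right, comm_add_right, comm_self, kab, kac]; ring
  have kae : comm a e = -1 := by rwa [kab, one_mul] at hc
  have kbe : comm b e = -1 := by
    rw [← hsum, comm_add_right, comm_add_right, comm_self, comm_symm, kab, kbc]; ring
  have kce : comm c e = 1 := by
    rw [← hsum, comm_add_right, comm_add_right, comm_self, comm_symm, kac, comm_symm, kbc]; ring
  have e0 := hF.exch (pauli a) (pauli b) (pauli c) (pauli e)
  have e1 := hF.sum_comm_mul c (pauli a) (pauli b) (pauli c) (pauli e)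
  rw [hF.mul_pauli c (pauli_anticomm_of (by rw [comm_symm, kac]))
    (pauli_anticomm_of (by rw [comm_symm, kbc])) rfl (pauli_comm_of kce)] at e1
  have e2 : ∑ v, (1 - comm c v) * F (pauli a * pauli v) (pauli b * pauli v) (pauli c) (pauli e)
      = 0 := by
    refine Finset.sum_eq_zero fun v _ => ?_
    rcases comm_eq c v with h | h
    · rw [h]; ring
    rw [hF.shift_eq_zero, mul_zero]
    have hev : comm e v = -(comm a v * comm b v) := by
      rw [← hsum, comm_add_left, comm_add_left, h]; ring
    have h2 : comm (a + v) (b + v) = comm a v * comm b v := by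
      rw [comm_add_left, comm_add_right, comm_add_right, comm_self, kab, comm_symm v b]; ring
    have h3 : comm (a + v) c = 1 := by rw [comm_add_left, comm_symm v, h, kac]; ring
    have h4 : comm (b + v) c = 1 := by rw [comm_add_left, comm_symm v, h, kbc]; ring
    rcases comm_eq (a + v) (b + v) with h5 | h5
    · have h6 : e = a + v + (b + v) + c := by
        rw [← hsum, add_add_add_comm, label_add_self, add_zero]
      rw [h6]
      exact hF.commuting h1 hs h5 h3 h4
    · refine hF.mixed h5 (h3.trans h4.symm) ?_
      rw [comm_add_left, comm_add_left, kae, kbe]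
  simp only [sub_mul, one_mul, Finset.sum_sub_distrib, e0, e1] at e2
  refine (mul_eq_zero.mp ?_).resolve_left (two_pow_ne_zero (n := n))
  linear_combination (1 / 2 : ℂ) * e2

theorem pauli_eq_zero (h1 : F 1 1 1 1 = 0)
    (hs : ∑ v, F (pauli v) (pauli v) (pauli v) (pauli v) = 0) (a b c e : PauliLabel n) :
    F (pauli a) (pauli b) (pauli c) (pauli e) = 0 := by
  by_cases hsum : a + b + c + e = 0
  swap
  · exact hF.eq_zero_of_sum_ne_zero hsum
  have he := label_eq_of_add_eq_zero hsum
  subst he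
  -- The signs among a, b, c determine those with the fourth label a + b + c. An odd number of
  -- anticommuting pairs is covered by `mixed`, exactly two by `cross`, none by `commuting`.
  rcases comm_eq a b with kab | kab <;> rcases comm_eq a c with kac | kac <;>
    rcases comm_eq b c with kbc | kbc
  · exact hF.commuting h1 hs kab kac kbc
  · rw [hF.symm₁₂, hF.symm₂₃]
    refine hF.mixed kbc ?_ ?_ <;>
    simp [comm_add_right, comm_self, comm_symm c a, comm_symm c b, comm_symm b a, kab, kac, kbc]
  · rw [hF.symm₂₃]
    refine hF.mixed kac ?_ ?_ <;>
    simp [comm_add_right, comm_self, comm_symm c a, comm_symm c b, kab, kac, kbc]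
  · exact hF.cross h1 hs rfl kab kac kbc
  · refine hF.mixed kab ?_ ?_ <;>
    simp [comm_add_right, comm_self, comm_symm b a, kab, kac, kbc]
  · rw [hF.symm₂₃]
    exact hF.cross h1 hs (by abel) kac kab (by rw [comm_symm, kbc])
  · rw [hF.symm₁₂, hF.symm₂₃]
    exact hF.cross h1 hs (by abel) kbc (by rw [comm_symm, kab]) (by rw [comm_symm, kac])
  · refine hF.mixed kab ?_ ?_ <;>
    simp [comm_add_right, comm_self, comm_symm b a, kab, kac, kbc]

/-- A Clifford-invariant quadrilinear form is determined by two of its values. -/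
theorem eq_zero (h1 : F 1 1 1 1 = 0)
    (hs : ∑ v, F (pauli v) (pauli v) (pauli v) (pauli v) = 0) (A B C D : Mat n) :
    F A B C D = 0 := by
  have h : ∀ A B C D : Mat n, (∀ a, F (pauli a) B C D = 0) → F A B C D = 0 := by
    intro A B C D hB
    have := hF.sum_smul Finset.univ (fun a => trace (A * pauli a)) pauli B C D
    rw [sum_trace_smul_pauli, hF.smul] at this
    simp only [hB, mul_zero, Finset.sum_const_zero] at this
    exact (mul_eq_zero.mp this).resolve_left two_pow_ne_zero
  refine h A B C D fun a => ?_
  rw [hF.symm₁₂]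
  refine h B _ C D fun b => ?_
  rw [hF.symm₂₃, hF.symm₁₂]
  refine h C _ _ D fun c => ?_
  rw [hF.symm₁₄]
  refine h D _ _ _ fun e => ?_
  exact hF.pauli_eq_zero h1 hs ..

end IsCliffordForm₄

/-! ### The Clifford group -/

theorem rot_mem_unitaryGroup (u : PauliLabel n) : rot u ∈ Matrix.unitaryGroup (Idx n) ℂ := by
  have h : rot u * 1 * (rot u)ᴴ = 1 := rot_conj_of_comm (by simp)
  rw [Matrix.mul_one] at h
  exact Matrix.mem_unitaryGroup_iff.mpr h

/-- The rotations as elements of the unitary group. -/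
noncomputable def rotUnitary (u : PauliLabel n) : Matrix.unitaryGroup (Idx n) ℂ :=
  ⟨rot u, rot_mem_unitaryGroup u⟩

theorem unitary_mul_conjTranspose (U : Matrix.unitaryGroup (Idx n) ℂ) :
    (U : Mat n) * (U : Mat n)ᴴ = 1 := Matrix.mem_unitaryGroup_iff.mp U.2

theorem unitary_conjTranspose_mul (U : Matrix.unitaryGroup (Idx n) ℂ) :
    (U : Mat n)ᴴ * (U : Mat n) = 1 := Matrix.mem_unitaryGroup_iff'.mp U.2

theorem unitary_coe_inv (U : Matrix.unitaryGroup (Idx n) ℂ) :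
    ((U⁻¹ : Matrix.unitaryGroup (Idx n) ℂ) : Mat n) = (U : Mat n)ᴴ := rfl

theorem exists_of_mem_pauliGroup {U : Matrix.unitaryGroup (Idx n) ℂ} (hU : U ∈ pauliGroup n) :
    ∃ (c : ℂ) (a : PauliLabel n), c ^ 4 = 1 ∧ (U : Mat n) = c • pauli a := by
  induction hU using Subgroup.closure_induction with
  | mem x hx =>
    obtain ⟨a, rfl⟩ := hx
    exact ⟨1, a, by norm_num, (one_smul _ _).symm⟩
  | one => exact ⟨1, 0, by norm_num, by rw [pauli_zero, one_smul]; rfl⟩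
  | mul x y _ _ hx hy =>
    obtain ⟨c, a, hc, ha⟩ := hx
    obtain ⟨c', b, hc', hb⟩ := hy
    obtain ⟨φ, hφ, hab⟩ := pauli_mul a b
    refine ⟨c * c' * φ, a + b, by rw [mul_pow, mul_pow, hc, hc', hφ]; norm_num, ?_⟩
    rw [Submonoid.coe_mul, ha, hb, Matrix.smul_mul, Matrix.mul_smul, hab, smul_smul, smul_smul,
      mul_assoc]
  | inv x _ hx =>
    obtain ⟨c, a, hc, ha⟩ := hx
    refine ⟨star c, a, by rw [← star_pow, hc, star_one], ?_⟩
    rw [unitary_coe_inv, ha, conjTranspose_smul, pauli_isHermitian]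

theorem finite_pow_four_eq_one : {c : ℂ | c ^ 4 = 1}.Finite := by
  refine (Set.finite_coe_iff.mp
    (inferInstance : Finite (Set.range fun c : rootsOfUnity 4 ℂ => ((c : ℂˣ) : ℂ)))).subset ?_
  intro c hc
  have hc0 : c ≠ 0 := by
    rintro rfl
    norm_num at hc
  refine ⟨⟨Units.mk0 c hc0, ?_⟩, rfl⟩
  rw [mem_rootsOfUnity]
  exact Units.ext hc

theorem finite_pauliGroup : Finite (pauliGroup n : Set (Matrix.unitaryGroup (Idx n) ℂ)) := by
  rw [Set.finite_coe_iff]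
  refine Set.Finite.of_finite_image (f := fun U => (U : Mat n)) ?_ Subtype.val_injective.injOn
  refine ((finite_pow_four_eq_one.prod (Set.finite_univ (α := PauliLabel n))).image
    fun p => p.1 • pauli p.2).subset ?_
  rintro _ ⟨U, hU, rfl⟩
  obtain ⟨c, a, hc, ha⟩ := exists_of_mem_pauliGroup hU
  exact ⟨(c, a), ⟨hc, trivial⟩, ha.symm⟩

theorem pauliUnitary_mem (a : PauliLabel n) : pauliUnitary a ∈ pauliGroup n :=
  Subgroup.subset_closure ⟨a, rfl⟩

theorem rotUnitary_mem (u : PauliLabel n) : rotUnitary u ∈ cliffordGroup n := by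
  have := finite_pauliGroup (n := n)
  -- Finiteness of the Pauli group makes one inclusion enough for normalizing it.
  refine Subgroup.mem_normalizer_fintype fun h hh => ?_
  induction hh using Subgroup.closure_induction with
  | mem x hx =>
    obtain ⟨a, rfl⟩ := hx
    have hval : ((rotUnitary u * pauliUnitary a * (rotUnitary u)⁻¹ :
        Matrix.unitaryGroup (Idx n) ℂ) : Mat n) = rot u * pauli a * (rot u)ᴴ := rfl
    rcases comm_eq u a with hc | hc
    · have h : rotUnitary u * pauliUnitary a * (rotUnitary u)⁻¹ = pauliUnitary a :=
        Subtype.ext (hval.trans (rot_conj_of_comm (pauli_comm_of hc)))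
      rw [h]
      exact pauliUnitary_mem a
    · obtain ⟨φ, hφ2, hφ⟩ := pauli_mul_sq a u
      rw [comm_symm, hc] at hφ2
      rw [rot_conj_of_anticomm (pauli_anticomm_of hc), hφ, smul_smul] at hval
      have h1 : (-Complex.I * φ) * (-Complex.I * φ) = 1 := by
        linear_combination (Complex.I * Complex.I) * hφ2 - Complex.I_mul_I
      rcases mul_self_eq_one_iff.mp h1 with h2 | h2
      · rw [h2, one_smul] at hval
        have h : rotUnitary u * pauliUnitary a * (rotUnitary u)⁻¹ = pauliUnitary (a + u) :=
          Subtype.ext hval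
        rw [h]
        exact pauliUnitary_mem _
      -- The sign -1 belongs to the Pauli group as the commutator W_u W_a W_u W_a of anticommuting
      -- operators.
      · have h : rotUnitary u * pauliUnitary a * (rotUnitary u)⁻¹
            = pauliUnitary u * pauliUnitary a * pauliUnitary u * pauliUnitary a
              * pauliUnitary (a + u) := by
          refine Subtype.ext (hval.trans ?_)
          change _ = pauli u * pauli a * pauli u * pauli a * pauli (a + u)
          rw [h2, pauli_conj_pauli, Matrix.smul_mul, pauli_mul_self, hc, Matrix.smul_mul,
            Matrix.one_mul]
        rw [h]
        exact mul_mem (mul_mem (mul_mem (mul_mem (pauliUnitary_mem _) (pauliUnitary_mem _))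
          (pauliUnitary_mem _)) (pauliUnitary_mem _)) (pauliUnitary_mem _)
  | one => simp
  | mul x y _ _ hx hy =>
    have h : rotUnitary u * (x * y) * (rotUnitary u)⁻¹
        = (rotUnitary u * x * (rotUnitary u)⁻¹) * (rotUnitary u * y * (rotUnitary u)⁻¹) := by group
    rw [h]
    exact mul_mem hx hy
  | inv x _ hx =>
    have h : rotUnitary u * x⁻¹ * (rotUnitary u)⁻¹
        = (rotUnitary u * x * (rotUnitary u)⁻¹)⁻¹ := by group
    rw [h]
    exact inv_mem hx

theorem clifford_conj_pauli {U : Matrix.unitaryGroup (Idx n) ℂ} (hU : U ∈ cliffordGroup n)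
    (a : PauliLabel n) :
    ∃ (c : ℂ) (b : PauliLabel n), c ^ 4 = 1 ∧
      (U : Mat n) * pauli a * (U : Mat n)ᴴ = c • pauli b := by
  have h : U * pauliUnitary a * U⁻¹ ∈ pauliGroup n :=
    (Subgroup.mem_normalizer_iff.mp hU _).mp (pauliUnitary_mem a)
  exact exists_of_mem_pauliGroup h

/-- Clifford unitaries permute the Pauli operators up to phases. -/
theorem clifford_permutes {U : Matrix.unitaryGroup (Idx n) ℂ} (hU : U ∈ cliffordGroup n) :
    ∃ π : Equiv.Perm (PauliLabel n), ∀ a, ∃ c : ℂ, c ^ 4 = 1 ∧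
      (U : Mat n) * pauli a * (U : Mat n)ᴴ = c • pauli (π a) := by
  choose c f hc hf using clifford_conj_pauli hU
  have hinj : Function.Injective f := by
    intro a b hab
    by_contra hne
    have h1 : (U : Mat n) * pauli a * (U : Mat n)ᴴ * ((U : Mat n) * pauli b * (U : Mat n)ᴴ)
        = (U : Mat n) * (pauli a * pauli b) * (U : Mat n)ᴴ := by
      have := unitary_conjTranspose_mul U
      calc _ = (U : Mat n) * pauli a * ((U : Mat n)ᴴ * (U : Mat n)) * pauli b * (U : Mat n)ᴴ := by
            simp only [Matrix.mul_assoc]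
        _ = _ := by rw [this]; simp only [Matrix.mul_assoc, Matrix.mul_one]
    have h2 := congrArg trace h1
    rw [hf, hf, hab, Matrix.smul_mul, Matrix.mul_smul, pauli_mul_self, trace_smul,
      trace_smul, trace_one_mat, smul_eq_mul, smul_eq_mul, trace_mul_cycle,
      unitary_conjTranspose_mul, Matrix.one_mul, trace_pauli_mul_pauli, if_neg hne] at h2
    have hne0 : ∀ x : PauliLabel n, c x ≠ 0 := fun x h0 => by
      have := hc x
      rw [h0] at this
      norm_num at this
    exact mul_ne_zero (hne0 a) (mul_ne_zero (hne0 b) two_pow_ne_zero) h2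
  exact ⟨Equiv.ofBijective f (Finite.injective_iff_bijective.mp hinj), fun a => ⟨c a, hc a, hf a⟩⟩

/-! ### The Clifford orbit -/

/-- Expand zz* in Pauli operators: the conjugate depends only on the label and the fourth root of
unity attached to each conjugated W_a, so there are finitely many possibilities. -/
theorem finite_cliffordOrbit (z : Vec n) : (cliffordOrbit z).Finite := by
  have hfin : Finite {c : ℂ | c ^ 4 = 1} := finite_pow_four_eq_one
  refine (Set.finite_range fun p : (PauliLabel n → PauliLabel n) ×
    (PauliLabel n → {c : ℂ | c ^ 4 = 1}) =>
      ((2 : ℂ) ^ n)⁻¹ • ∑ a, (trace (proj z * pauli a) * (p.2 a : ℂ)) • pauli (p.1 a)).subset ?_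
  rintro _ ⟨U, hU, rfl⟩
  choose c f hc hf using clifford_conj_pauli hU
  refine ⟨(f, fun a => ⟨c a, hc a⟩), ?_⟩
  have h : proj z = ((2 : ℂ) ^ n)⁻¹ • ∑ a, trace (proj z * pauli a) • pauli a := by
    rw [sum_trace_smul_pauli, smul_smul, inv_mul_cancel₀ two_pow_ne_zero, one_smul]
  conv_rhs => rw [h]
  simp only [Matrix.mul_smul, Matrix.smul_mul, Finset.mul_sum, Finset.sum_mul, hf, smul_smul]

theorem conj_mem_cliffordOrbit {z : Vec n} {A : Mat n} (hA : A ∈ cliffordOrbit z)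
    {U : Matrix.unitaryGroup (Idx n) ℂ} (hU : U ∈ cliffordGroup n) :
    (U : Mat n) * A * (U : Mat n)ᴴ ∈ cliffordOrbit z := by
  obtain ⟨V, hV, rfl⟩ := hA
  refine ⟨U * V, mul_mem hU hV, ?_⟩
  rw [Submonoid.coe_mul, conjTranspose_mul]
  simp only [Matrix.mul_assoc]

theorem sum_cliffordOrbit_conj (z : Vec n) (f : Mat n → ℂ)
    {U : Matrix.unitaryGroup (Idx n) ℂ} (hU : U ∈ cliffordGroup n) :
    ∑ A ∈ (finite_cliffordOrbit z).toFinset, f ((U : Mat n) * A * (U : Mat n)ᴴ)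
      = ∑ A ∈ (finite_cliffordOrbit z).toFinset, f A := by
  refine Finset.sum_nbij' (fun A => (U : Mat n) * A * (U : Mat n)ᴴ)
    (fun A => (U : Mat n)ᴴ * A * (U : Mat n)) ?_ ?_ ?_ ?_ fun _ _ => rfl
  · intro A hA
    rw [Set.Finite.mem_toFinset] at hA ⊢
    exact conj_mem_cliffordOrbit hA hU
  · intro A hA
    rw [Set.Finite.mem_toFinset] at hA ⊢
    have := conj_mem_cliffordOrbit hA (inv_mem hU)
    rwa [unitary_coe_inv, conjTranspose_conjTranspose] at this
  · intro A _
    calc _ = ((U : Mat n)ᴴ * (U : Mat n)) * A * ((U : Mat n)ᴴ * (U : Mat n)) := by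
          simp only [Matrix.mul_assoc]
      _ = A := by rw [unitary_conjTranspose_mul, Matrix.one_mul, Matrix.mul_one]
  · intro A _
    calc _ = ((U : Mat n) * (U : Mat n)ᴴ) * A * ((U : Mat n) * (U : Mat n)ᴴ) := by
          simp only [Matrix.mul_assoc]
      _ = A := by rw [unitary_mul_conjTranspose, Matrix.one_mul, Matrix.mul_one]

theorem proj_eq (v : Vec n) : proj v = vecMulVec v.ofLp (star v.ofLp) := rfl

theorem proj_mul_mul_proj (v : Vec n) (B : Mat n) :
    proj v * B * proj v = trace (B * proj v) • proj v := by
  rw [proj_eq, Matrix.mul_assoc, mul_vecMulVec, vecMulVec_mul_vecMulVec, trace_vecMulVec]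
  rw [dotProduct_comm]
  ext x y
  simp [vecMulVec_apply]
  ring

theorem trace_proj {v : Vec n} (hv : ‖v‖ = 1) : trace (proj v) = 1 := by
  have h := EuclideanSpace.norm_sq_eq v
  rw [hv] at h
  have h2 : trace (proj v) = ((∑ i, ‖v i‖ ^ 2 : ℝ) : ℂ) := by
    simp [trace, proj, Complex.mul_conj, Complex.normSq_eq_norm_sq]
  rw [h2, ← h]
  norm_num

theorem conjTranspose_proj (v : Vec n) : (proj v)ᴴ = proj v := by
  ext x y
  simp [proj, mul_comm]

theorem orbit_conjTranspose {z : Vec n} {A : Mat n} (hA : A ∈ cliffordOrbit z) : Aᴴ = A := by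
  obtain ⟨U, -, rfl⟩ := hA
  rw [conjTranspose_mul, conjTranspose_mul, conjTranspose_conjTranspose, conjTranspose_proj,
    Matrix.mul_assoc]

theorem orbit_trace {z : Vec n} (hz : ‖z‖ = 1) {A : Mat n} (hA : A ∈ cliffordOrbit z) :
    trace A = 1 := by
  obtain ⟨U, -, rfl⟩ := hA
  rw [trace_mul_cycle, unitary_conjTranspose_mul, Matrix.one_mul, trace_proj hz]

/-- Orbit elements have rank one. This is what makes the moment forms satisfy the swap identity. -/
theorem orbit_mul_mul {z : Vec n} {A : Mat n} (hA : A ∈ cliffordOrbit z) (B : Mat n) :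
    A * B * A = trace (B * A) • A := by
  obtain ⟨U, -, rfl⟩ := hA
  have h := proj_mul_mul_proj z ((U : Mat n)ᴴ * B * (U : Mat n))
  have ht : trace ((U : Mat n)ᴴ * B * (U : Mat n) * proj z)
      = trace (B * ((U : Mat n) * proj z * (U : Mat n)ᴴ)) := by
    rw [Matrix.mul_assoc, Matrix.mul_assoc, trace_mul_comm]
    simp only [Matrix.mul_assoc]
  calc _ = (U : Mat n) * (proj z * ((U : Mat n)ᴴ * B * (U : Mat n)) * proj z) * (U : Mat n)ᴴ := by
        simp only [Matrix.mul_assoc]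
    _ = _ := by rw [h, ht, Matrix.mul_smul, Matrix.smul_mul]

/-- The fourth moment of the Pauli coefficients is constant on a Clifford orbit. -/
theorem orbit_sum_pow_four {z : Vec n} {A : Mat n} (hA : A ∈ cliffordOrbit z) :
    ∑ a, trace (pauli a * A) ^ 4 = ∑ a, trace (pauli a * proj z) ^ 4 := by
  obtain ⟨U, hU, rfl⟩ := hA
  obtain ⟨π, hπ⟩ := clifford_permutes hU
  rw [← Equiv.sum_comp π]
  refine Finset.sum_congr rfl fun a _ => ?_
  obtain ⟨c, hc, h⟩ := hπ a
  have h2 : c * trace (pauli (π a) * ((U : Mat n) * proj z * (U : Mat n)ᴴ))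
      = trace (pauli a * proj z) := by
    rw [← smul_eq_mul, ← trace_smul, ← Matrix.smul_mul, ← h]
    calc _ = trace ((U : Mat n) * pauli a * ((U : Mat n)ᴴ * (U : Mat n)) * proj z * (U : Mat n)ᴴ) := by
          simp only [Matrix.mul_assoc]
      _ = trace ((U : Mat n)ᴴ * ((U : Mat n) * (pauli a * proj z))) := by
          rw [unitary_conjTranspose_mul, Matrix.mul_one, trace_mul_comm]
          simp only [Matrix.mul_assoc]
      _ = _ := by rw [← Matrix.mul_assoc, unitary_conjTranspose_mul, Matrix.one_mul]
  rw [← h2, mul_pow, hc, one_mul]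

/-! ### Examples of Clifford-invariant forms -/

/-- The sum over all permutations of four tensor factors of the trace of the permutation operator
times `A ⊗ B ⊗ C ⊗ D`. -/
noncomputable def permForm (A B C D : Mat n) : ℂ :=
    trace A * trace B * trace C * trace D +
    trace (A * B) * trace C * trace D +
    trace (A * C) * trace B * trace D +
    trace (A * D) * trace B * trace C +
    trace (B * C) * trace A * trace D +
    trace (B * D) * trace A * trace C +
    trace (C * D) * trace A * trace B +
    trace (A * B) * trace (C * D) +
    trace (A * C) * trace (B * D) +
    trace (A * D) * trace (B * C) +
    trace (A * B * C) * trace D +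
    trace (A * C * B) * trace D +
    trace (A * B * D) * trace C +
    trace (A * D * B) * trace C +
    trace (A * C * D) * trace B +
    trace (A * D * C) * trace B +
    trace (B * C * D) * trace A +
    trace (B * D * C) * trace A +
    trace (A * B * C * D) +
    trace (A * B * D * C) +
    trace (A * C * B * D) +
    trace (A * C * D * B) +
    trace (A * D * B * C) +
    trace (A * D * C * B)

/-- The permutation form summed over multiplication by the fourth tensor powers of all Pauli operators. -/
noncomputable def pauliForm (A B C D : Mat n) : ℂ :=
  ∑ a, permForm (pauli a * A) (pauli a * B) (pauli a * C) (pauli a * D)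

theorem trace_mul_cyclic3 (A B C : Mat n) : trace (A * B * C) = trace (B * C * A) := by
  rw [Matrix.mul_assoc, trace_mul_comm]

theorem trace_mul_cyclic4 (A B C D : Mat n) : trace (A * B * C * D) = trace (B * C * D * A) := by
  rw [Matrix.mul_assoc, Matrix.mul_assoc, trace_mul_comm]
  simp only [Matrix.mul_assoc]

theorem permForm_symm₁₂ (A B C D : Mat n) : permForm A B C D = permForm B A C D := by
  unfold permForm
  rw [show trace (B * A) = trace (A * B) by
      rw [trace_mul_comm],
    show trace (B * A * C) = trace (A * C * B) by
      rw [trace_mul_cyclic3],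
    show trace (B * C * A) = trace (A * B * C) by
      rw [trace_mul_cyclic3, trace_mul_cyclic3],
    show trace (B * A * D) = trace (A * D * B) by
      rw [trace_mul_cyclic3],
    show trace (B * D * A) = trace (A * B * D) by
      rw [trace_mul_cyclic3, trace_mul_cyclic3],
    show trace (B * A * C * D) = trace (A * C * D * B) by
      rw [trace_mul_cyclic4],
    show trace (B * A * D * C) = trace (A * D * C * B) by
      rw [trace_mul_cyclic4],
    show trace (B * C * A * D) = trace (A * D * B * C) by
      rw [trace_mul_cyclic4, trace_mul_cyclic4],
    show trace (B * C * D * A) = trace (A * B * C * D) by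
      rw [trace_mul_cyclic4, trace_mul_cyclic4, trace_mul_cyclic4],
    show trace (B * D * A * C) = trace (A * C * B * D) by
      rw [trace_mul_cyclic4, trace_mul_cyclic4],
    show trace (B * D * C * A) = trace (A * B * D * C) by
      rw [trace_mul_cyclic4, trace_mul_cyclic4, trace_mul_cyclic4]]
  ring

theorem permForm_symm₂₃ (A B C D : Mat n) : permForm A B C D = permForm A C B D := by
  unfold permForm
  rw [show trace (C * B) = trace (B * C) by
      rw [trace_mul_comm],
    show trace (C * B * D) = trace (B * D * C) by
      rw [trace_mul_cyclic3],
    show trace (C * D * B) = trace (B * C * D) by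
      rw [trace_mul_cyclic3, trace_mul_cyclic3]]
  ring

theorem permForm_symm₃₄ (A B C D : Mat n) : permForm A B C D = permForm A B D C := by
  unfold permForm
  rw [show trace (D * C) = trace (C * D) by
      rw [trace_mul_comm]]
  ring

theorem permForm_exch (A B C D : Mat n) :
    ∑ v, permForm (A * pauli v) (B * pauli v) C D = 2 ^ n * permForm A B C D := by
  -- Each trace is rotated cyclically until its dependence on v has the shape tr(P W_v) tr(Q W_v) or
  -- tr(P W_v Q W_v), the two contractions with known sums. Summation then permutes the 24 terms.
  have h : ∀ v : PauliLabel n, permForm (A * pauli v) (B * pauli v) C D =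
      trace (A * pauli v) * trace (B * pauli v) * trace C * trace D +
      trace (A * pauli v * (B * pauli v)) * trace C * trace D +
      trace (C * A * pauli v) * trace (B * pauli v) * trace D +
      trace (D * A * pauli v) * trace (B * pauli v) * trace C +
      trace (C * B * pauli v) * trace (A * pauli v) * trace D +
      trace (D * B * pauli v) * trace (A * pauli v) * trace C +
      trace (A * pauli v) * trace (B * pauli v) * trace (C * D) +
      trace (A * pauli v * (B * pauli v)) * trace (C * D) +
      trace (C * A * pauli v) * trace (D * B * pauli v) +
      trace (D * A * pauli v) * trace (C * B * pauli v) +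
      trace (C * A * pauli v * (B * pauli v)) * trace D +
      trace (A * pauli v * (C * B * pauli v)) * trace D +
      trace (D * A * pauli v * (B * pauli v)) * trace C +
      trace (A * pauli v * (D * B * pauli v)) * trace C +
      trace (C * D * A * pauli v) * trace (B * pauli v) +
      trace (D * C * A * pauli v) * trace (B * pauli v) +
      trace (C * D * B * pauli v) * trace (A * pauli v) +
      trace (D * C * B * pauli v) * trace (A * pauli v) +
      trace (C * D * A * pauli v * (B * pauli v)) +
      trace (D * C * A * pauli v * (B * pauli v)) +
      trace (D * A * pauli v * (C * B * pauli v)) +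
      trace (A * pauli v * (C * D * B * pauli v)) +
      trace (C * A * pauli v * (D * B * pauli v)) +
      trace (A * pauli v * (D * C * B * pauli v)) := by
    intro v
    unfold permForm
    simp only [← Matrix.mul_assoc]
    rw [show trace (A * pauli v * C) = trace (C * A * pauli v) by
        simpa only [← Matrix.mul_assoc] using trace_mul_comm (A * pauli v) (C),
      show trace (A * pauli v * D) = trace (D * A * pauli v) by
        simpa only [← Matrix.mul_assoc] using trace_mul_comm (A * pauli v) (D),
      show trace (B * pauli v * C) = trace (C * B * pauli v) by
        simpa only [← Matrix.mul_assoc] using trace_mul_comm (B * pauli v) (C),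
      show trace (B * pauli v * D) = trace (D * B * pauli v) by
        simpa only [← Matrix.mul_assoc] using trace_mul_comm (B * pauli v) (D),
      show trace (A * pauli v * B * pauli v * C) = trace (C * A * pauli v * B * pauli v) by
        simpa only [← Matrix.mul_assoc] using trace_mul_comm (A * pauli v * B * pauli v) (C),
      show trace (A * pauli v * B * pauli v * D) = trace (D * A * pauli v * B * pauli v) by
        simpa only [← Matrix.mul_assoc] using trace_mul_comm (A * pauli v * B * pauli v) (D),
      show trace (A * pauli v * C * D) = trace (C * D * A * pauli v) by
        simpa only [← Matrix.mul_assoc] using trace_mul_comm (A * pauli v) (C * D),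
      show trace (A * pauli v * D * C) = trace (D * C * A * pauli v) by
        simpa only [← Matrix.mul_assoc] using trace_mul_comm (A * pauli v) (D * C),
      show trace (B * pauli v * C * D) = trace (C * D * B * pauli v) by
        simpa only [← Matrix.mul_assoc] using trace_mul_comm (B * pauli v) (C * D),
      show trace (B * pauli v * D * C) = trace (D * C * B * pauli v) by
        simpa only [← Matrix.mul_assoc] using trace_mul_comm (B * pauli v) (D * C),
      show trace (A * pauli v * B * pauli v * C * D) = trace (C * D * A * pauli v * B * pauli v) by
        simpa only [← Matrix.mul_assoc] using trace_mul_comm (A * pauli v * B * pauli v) (C * D),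
      show trace (A * pauli v * B * pauli v * D * C) = trace (D * C * A * pauli v * B * pauli v) by
        simpa only [← Matrix.mul_assoc] using trace_mul_comm (A * pauli v * B * pauli v) (D * C),
      show trace (A * pauli v * C * B * pauli v * D) = trace (D * A * pauli v * C * B * pauli v) by
        simpa only [← Matrix.mul_assoc] using trace_mul_comm (A * pauli v * C * B * pauli v) (D),
      show trace (A * pauli v * D * B * pauli v * C) = trace (C * A * pauli v * D * B * pauli v) by
        simpa only [← Matrix.mul_assoc] using trace_mul_comm (A * pauli v * D * B * pauli v) (C)]
    ring
  simp only [h, Finset.sum_add_distrib, ← Finset.sum_mul, sum_trace_mul_pauli_mul_trace,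
    sum_trace_mul_pauli_mul_pauli]
  unfold permForm
  simp only [← Matrix.mul_assoc]
  rw [show trace (C * A * B) = trace (A * B * C) by
      simpa only [← Matrix.mul_assoc] using trace_mul_comm (C) (A * B),
    show trace (D * A * B) = trace (A * B * D) by
      simpa only [← Matrix.mul_assoc] using trace_mul_comm (D) (A * B),
    show trace (C * B * A) = trace (A * C * B) by
      simpa only [← Matrix.mul_assoc] using trace_mul_comm (C * B) (A),
    show trace (D * B * A) = trace (A * D * B) by
      simpa only [← Matrix.mul_assoc] using trace_mul_comm (D * B) (A),
    show trace (C * A * D * B) = trace (A * D * B * C) by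
      simpa only [← Matrix.mul_assoc] using trace_mul_comm (C) (A * D * B),
    show trace (D * A * C * B) = trace (A * C * B * D) by
      simpa only [← Matrix.mul_assoc] using trace_mul_comm (D) (A * C * B),
    show trace (C * A) = trace (A * C) by
      simpa only [← Matrix.mul_assoc] using trace_mul_comm (C) (A),
    show trace (C * B) = trace (B * C) by
      simpa only [← Matrix.mul_assoc] using trace_mul_comm (C) (B),
    show trace (D * A) = trace (A * D) by
      simpa only [← Matrix.mul_assoc] using trace_mul_comm (D) (A),
    show trace (D * B) = trace (B * D) by
      simpa only [← Matrix.mul_assoc] using trace_mul_comm (D) (B),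
    show trace (C * D * A * B) = trace (A * B * C * D) by
      simpa only [← Matrix.mul_assoc] using trace_mul_comm (C * D) (A * B),
    show trace (D * C * A * B) = trace (A * B * D * C) by
      simpa only [← Matrix.mul_assoc] using trace_mul_comm (D * C) (A * B),
    show trace (C * D * B * A) = trace (A * C * D * B) by
      simpa only [← Matrix.mul_assoc] using trace_mul_comm (C * D * B) (A),
    show trace (D * C * B * A) = trace (A * D * C * B) by
      simpa only [← Matrix.mul_assoc] using trace_mul_comm (D * C * B) (A),
    show trace (C * D * A) = trace (A * C * D) by
      simpa only [← Matrix.mul_assoc] using trace_mul_comm (C * D) (A),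
    show trace (D * C * A) = trace (A * D * C) by
      simpa only [← Matrix.mul_assoc] using trace_mul_comm (D * C) (A),
    show trace (C * D * B) = trace (B * C * D) by
      simpa only [← Matrix.mul_assoc] using trace_mul_comm (C * D) (B),
    show trace (D * C * B) = trace (B * D * C) by
      simpa only [← Matrix.mul_assoc] using trace_mul_comm (D * C) (B)]
  ring

theorem permForm_add (A A' B C D : Mat n) :
    permForm (A + A') B C D = permForm A B C D + permForm A' B C D := by
  unfold permForm
  simp only [Matrix.add_mul, trace_add]
  ring

theorem permForm_smul (c : ℂ) (A B C D : Mat n) :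
    permForm (c • A) B C D = c * permForm A B C D := by
  unfold permForm
  simp only [Matrix.smul_mul, trace_smul, smul_eq_mul]
  ring

theorem permForm_conj {U V : Mat n} (h : V * U = 1) (A B C D : Mat n) :
    permForm (U * A * V) (U * B * V) (U * C * V) (U * D * V) = permForm A B C D := by
  have hmul : ∀ M N : Mat n, U * M * V * (U * N * V) = U * (M * N) * V := by
    intro M N
    calc _ = U * M * (V * U) * N * V := by simp only [Matrix.mul_assoc]
      _ = _ := by rw [h]; simp only [Matrix.mul_assoc, Matrix.one_mul]
  have htr : ∀ M : Mat n, trace (U * M * V) = trace M := by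
    intro M
    rw [trace_mul_cycle, h, Matrix.one_mul]
  simp only [permForm, hmul, htr]

theorem rot_conjTranspose_mul (u : PauliLabel n) : (rot u)ᴴ * rot u = 1 :=
  unitary_conjTranspose_mul (rotUnitary u)

theorem isCliffordForm₄_permForm : IsCliffordForm₄ (permForm (n := n)) where
  add := permForm_add
  smul := permForm_smul
  symm₁₂ := permForm_symm₁₂
  symm₂₃ := permForm_symm₂₃
  symm₃₄ := permForm_symm₃₄
  conj u := permForm_conj (rot_conjTranspose_mul u)
  exch := permForm_exch

theorem permForm_smul_all (c : ℂ) (A B C D : Mat n) :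
    permForm (c • A) (c • B) (c • C) (c • D) = c ^ 4 * permForm A B C D := by
  have h := isCliffordForm₄_permForm (n := n)
  rw [h.smul, h.smul₂, h.smul₃, h.smul₄]
  ring

/-- The rotation permutes the Pauli operators up to fourth roots of unity, and these drop out of a
form of degree four. -/
theorem pauliForm_conj (u : PauliLabel n) (A B C D : Mat n) :
    pauliForm (rot u * A * (rot u)ᴴ) (rot u * B * (rot u)ᴴ) (rot u * C * (rot u)ᴴ)
      (rot u * D * (rot u)ᴴ) = pauliForm A B C D := by
  obtain ⟨π, hπ⟩ := clifford_permutes (rotUnitary_mem u)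
  unfold pauliForm
  rw [← Equiv.sum_comp π]
  refine Finset.sum_congr rfl fun a _ => ?_
  obtain ⟨c, hc, h⟩ := hπ a
  have hU := rot_conjTranspose_mul u
  have key : ∀ M : Mat n, c • (pauli (π a) * (rot u * M * (rot u)ᴴ))
      = rot u * (pauli a * M) * (rot u)ᴴ := by
    intro M
    rw [← Matrix.smul_mul, ← h]
    change rot u * pauli a * (rot u)ᴴ * _ = _
    calc _ = rot u * pauli a * ((rot u)ᴴ * rot u) * M * (rot u)ᴴ := by
          simp only [Matrix.mul_assoc]
      _ = _ := by rw [hU]; simp only [Matrix.mul_assoc, Matrix.one_mul]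
  rw [← one_mul (permForm (pauli (π a) * _) _ _ _), ← hc, ← permForm_smul_all, key, key, key, key,
    permForm_conj hU]

theorem isCliffordForm₄_pauliForm : IsCliffordForm₄ (pauliForm (n := n)) where
  add A A' B C D := by
    simp only [pauliForm, Matrix.mul_add, permForm_add, Finset.sum_add_distrib]
  smul c A B C D := by
    simp only [pauliForm, Matrix.mul_smul, permForm_smul, Finset.mul_sum]
  symm₁₂ A B C D := Finset.sum_congr rfl fun _ _ => permForm_symm₁₂ ..
  symm₂₃ A B C D := Finset.sum_congr rfl fun _ _ => permForm_symm₂₃ ..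
  symm₃₄ A B C D := Finset.sum_congr rfl fun _ _ => permForm_symm₃₄ ..
  conj := pauliForm_conj
  exch A B C D := by
    unfold pauliForm
    rw [Finset.sum_comm, Finset.mul_sum]
    refine Finset.sum_congr rfl fun a _ => ?_
    simp only [← Matrix.mul_assoc]
    exact permForm_exch ..

/-- The (unnormalized) fourth moment form of a Clifford orbit. -/
noncomputable def orbitForm₄ (z : Vec n) (A B C D : Mat n) : ℂ :=
  ∑ M ∈ (finite_cliffordOrbit z).toFinset,
    trace (A * M) * trace (B * M) * trace (C * M) * trace (D * M)

/-- The (unnormalized) second moment form of a Clifford orbit. -/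
noncomputable def orbitForm₂ (z : Vec n) (A B : Mat n) : ℂ :=
  ∑ M ∈ (finite_cliffordOrbit z).toFinset, trace (A * M) * trace (B * M)

theorem trace_rot_conj (u : PauliLabel n) (A M : Mat n) :
    trace (rot u * A * (rot u)ᴴ * (rot u * M * (rot u)ᴴ)) = trace (A * M) := by
  have hU := rot_conjTranspose_mul u
  calc _ = trace (rot u * (A * ((rot u)ᴴ * rot u) * M) * (rot u)ᴴ) := by
        simp only [Matrix.mul_assoc]
    _ = _ := by rw [trace_mul_cycle, hU, Matrix.mul_one, Matrix.one_mul]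

theorem orbit_exch {z : Vec n} {M : Mat n} (hM : M ∈ cliffordOrbit z) (A B : Mat n) :
    ∑ v, trace (A * pauli v * M) * trace (B * pauli v * M)
      = 2 ^ n * (trace (A * M) * trace (B * M)) := by
  have h : ∀ v : PauliLabel n, trace (A * pauli v * M) * trace (B * pauli v * M)
      = trace (M * A * pauli v) * trace (M * B * pauli v) := fun v => by
    rw [trace_mul_cycle, trace_mul_cycle B]
  simp only [h, sum_trace_mul_pauli_mul_trace]
  rw [← Matrix.mul_assoc, orbit_mul_mul hM, Matrix.smul_mul, trace_smul, smul_eq_mul,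
    trace_mul_comm M]

theorem isCliffordForm₄_orbitForm (z : Vec n) : IsCliffordForm₄ (orbitForm₄ z) where
  add A A' B C D := by
    simp only [orbitForm₄, trace_add, add_mul, Finset.sum_add_distrib]
  smul c A B C D := by
    simp only [orbitForm₄, Matrix.smul_mul, trace_smul, smul_eq_mul, Finset.mul_sum, mul_assoc]
  symm₁₂ A B C D := Finset.sum_congr rfl fun _ _ => by ring
  symm₂₃ A B C D := Finset.sum_congr rfl fun _ _ => by ring
  symm₃₄ A B C D := Finset.sum_congr rfl fun _ _ => by ring
  conj u A B C D := by
    unfold orbitForm₄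
    rw [← sum_cliffordOrbit_conj z _ (rotUnitary_mem u)]
    refine Finset.sum_congr rfl fun M _ => ?_
    change trace (_ * (rot u * M * (rot u)ᴴ)) * trace (_ * (rot u * M * (rot u)ᴴ))
      * trace (_ * (rot u * M * (rot u)ᴴ)) * trace (_ * (rot u * M * (rot u)ᴴ)) = _
    simp only [trace_rot_conj]
  exch A B C D := by
    unfold orbitForm₄
    rw [Finset.sum_comm, Finset.mul_sum]
    refine Finset.sum_congr rfl fun M hM => ?_
    rw [Set.Finite.mem_toFinset] at hM
    simp only [← Finset.sum_mul, orbit_exch hM]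
    ring

theorem isCliffordForm₂_orbitForm (z : Vec n) : IsCliffordForm₂ (orbitForm₂ z) where
  add A A' B := by
    simp only [orbitForm₂, trace_add, add_mul, Finset.sum_add_distrib]
  smul c A B := by
    simp only [orbitForm₂, Matrix.smul_mul, trace_smul, smul_eq_mul, Finset.mul_sum, mul_assoc]
  symm A B := Finset.sum_congr rfl fun _ _ => by ring
  conj u A B := by
    unfold orbitForm₂
    rw [← sum_cliffordOrbit_conj z _ (rotUnitary_mem u)]
    refine Finset.sum_congr rfl fun M _ => ?_
    change trace (_ * (rot u * M * (rot u)ᴴ)) * trace (_ * (rot u * M * (rot u)ᴴ)) = _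
    simp only [trace_rot_conj]
  exch A B := by
    unfold orbitForm₂
    rw [Finset.sum_comm, Finset.mul_sum]
    refine Finset.sum_congr rfl fun M hM => ?_
    rw [Set.Finite.mem_toFinset] at hM
    exact orbit_exch hM A B

theorem isCliffordForm₂_trace :
    IsCliffordForm₂ fun A B : Mat n => trace (A * B) + trace A * trace B where
  add A A' B := by rw [Matrix.add_mul, trace_add, trace_add]; ring
  smul c A B := by rw [Matrix.smul_mul, trace_smul, trace_smul, smul_eq_mul, smul_eq_mul]; ring
  symm A B := by rw [trace_mul_comm]; ring
  conj u A B := by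
    have h : ∀ A : Mat n, trace (rot u * A * (rot u)ᴴ) = trace A := fun A => by
      rw [trace_mul_cycle, rot_conjTranspose_mul, Matrix.one_mul]
    rw [trace_rot_conj, h, h]
  exch A B := by
    rw [Finset.sum_add_distrib, sum_trace_mul_pauli_mul_trace, sum_trace_mul_pauli_mul_pauli]
    ring

/-! ### Evaluation of the invariant forms -/

/-- Each permutation contributes d to the power of its number of cycles. -/
theorem permForm_one : permForm (1 : Mat n) 1 1 1
    = (2 : ℂ) ^ n * (2 ^ n + 1) * (2 ^ n + 2) * (2 ^ n + 3) := by
  unfold permForm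
  simp only [Matrix.one_mul, trace_one_mat]
  ring

/-- Odd powers of W_v are traceless, so only the three double transpositions and the six 4-cycles
contribute. -/
theorem permForm_pauli {v : PauliLabel n} (hv : v ≠ 0) :
    permForm (pauli v) (pauli v) (pauli v) (pauli v) = 3 * (2 ^ n) ^ 2 + 6 * 2 ^ n := by
  unfold permForm
  simp only [pauli_mul_self, Matrix.one_mul, trace_one_mat, trace_pauli hv]
  ring

theorem sum_permForm_pauli :
    ∑ v : PauliLabel n, permForm (pauli v) (pauli v) (pauli v) (pauli v)
      = 4 * (2 ^ n) ^ 2 * (2 ^ n + 1) * (2 ^ n + 2) := by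
  rw [← Finset.add_sum_erase _ _ (Finset.mem_univ (0 : PauliLabel n)), pauli_zero, permForm_one,
    Finset.sum_congr rfl fun v hv => permForm_pauli (Finset.ne_of_mem_erase hv), Finset.sum_const,
    Finset.card_erase_of_mem (Finset.mem_univ _), Finset.card_univ, nsmul_eq_mul,
    Nat.cast_sub Fintype.card_pos, card_label]
  push_cast
  ring

theorem pauliForm_one : pauliForm (1 : Mat n) 1 1 1
    = 4 * (2 ^ n) ^ 2 * (2 ^ n + 1) * (2 ^ n + 2) := by
  unfold pauliForm
  simp only [Matrix.mul_one]
  exact sum_permForm_pauli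

theorem sum_pauliForm_pauli :
    ∑ v : PauliLabel n, pauliForm (pauli v) (pauli v) (pauli v) (pauli v)
      = (2 ^ n) ^ 2 * (4 * (2 ^ n) ^ 2 * (2 ^ n + 1) * (2 ^ n + 2)) := by
  unfold pauliForm
  rw [Finset.sum_comm]
  have h : ∀ a : PauliLabel n, ∑ v : PauliLabel n, permForm (pauli a * pauli v) (pauli a * pauli v)
      (pauli a * pauli v) (pauli a * pauli v) = 4 * (2 ^ n) ^ 2 * (2 ^ n + 1) * (2 ^ n + 2) := by
    intro a
    rw [← sum_permForm_pauli, ← sum_comm_add a]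
    refine Finset.sum_congr rfl fun v _ => ?_
    obtain ⟨c, hc, h⟩ := pauli_mul a (a + v)
    rw [h, label_add_cancel, permForm_smul_all, hc, one_mul]
  rw [Finset.sum_congr rfl fun a _ => h a, Finset.sum_const, Finset.card_univ, nsmul_eq_mul,
    card_label]

theorem orbitForm₂_eq {z : Vec n} (hz : ‖z‖ = 1) (A B : Mat n) :
    orbitForm₂ z A B = (finite_cliffordOrbit z).toFinset.card / (2 ^ n * (2 ^ n + 1))
      * (trace (A * B) + trace A * trace B) := by
  rw [← sub_eq_zero]
  refine ((isCliffordForm₂_orbitForm z).sub (isCliffordForm₂_trace.const_mul _)).eq_zero ?_ A B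
  have h : orbitForm₂ z 1 1 = (finite_cliffordOrbit z).toFinset.card := by
    unfold orbitForm₂
    rw [Finset.sum_congr rfl fun M hM => by
      rw [Matrix.one_mul, orbit_trace hz ((finite_cliffordOrbit z).mem_toFinset.mp hM)]]
    simp
  have := two_pow_ne_zero (n := n)
  have := two_pow_add_one_ne_zero (n := n)
  rw [h, Matrix.one_mul, trace_one_mat]
  field_simp
  ring

/-- By uniqueness, two values need matching: `h1` matches them at the identity and `h2` matches the
diagonal Pauli sums, which are constant along the orbit. -/
theorem orbitForm₄_eq {z : Vec n} (hz : ‖z‖ = 1) {p q : ℂ}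
    (h1 : p * (4 * (2 ^ n) ^ 2 * (2 ^ n + 1) * (2 ^ n + 2))
      + q * (2 ^ n * (2 ^ n + 1) * (2 ^ n + 2) * (2 ^ n + 3)) = 1)
    (h2 : p * ((2 ^ n) ^ 2 * (4 * (2 ^ n) ^ 2 * (2 ^ n + 1) * (2 ^ n + 2)))
      + q * (4 * (2 ^ n) ^ 2 * (2 ^ n + 1) * (2 ^ n + 2)) = ∑ a, trace (pauli a * proj z) ^ 4)
    (A B C D : Mat n) :
    orbitForm₄ z A B C D = (finite_cliffordOrbit z).toFinset.card
      * (p * pauliForm A B C D + q * permForm A B C D) := by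
  rw [← sub_eq_zero]
  have hform := (isCliffordForm₄_orbitForm z).sub
    ((isCliffordForm₄_pauliForm.const_mul ((finite_cliffordOrbit z).toFinset.card * p)).sub
      (isCliffordForm₄_permForm.const_mul (-((finite_cliffordOrbit z).toFinset.card * q))))
  rw [← hform.eq_zero ?_ ?_ A B C D]
  · ring
  · have h : orbitForm₄ z 1 1 1 1 = (finite_cliffordOrbit z).toFinset.card := by
      unfold orbitForm₄
      rw [Finset.sum_congr rfl fun M hM => by
        rw [Matrix.one_mul, orbit_trace hz ((finite_cliffordOrbit z).mem_toFinset.mp hM)]]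
      simp
    rw [h, pauliForm_one, permForm_one]
    linear_combination (-((finite_cliffordOrbit z).toFinset.card : ℂ)) * h1
  · have h : ∑ v, orbitForm₄ z (pauli v) (pauli v) (pauli v) (pauli v)
        = (finite_cliffordOrbit z).toFinset.card * ∑ a, trace (pauli a * proj z) ^ 4 := by
      unfold orbitForm₄
      rw [Finset.sum_comm, ← nsmul_eq_mul, ← Finset.sum_const]
      refine Finset.sum_congr rfl fun M hM => ?_
      rw [← orbit_sum_pow_four ((finite_cliffordOrbit z).mem_toFinset.mp hM)]
      exact Finset.sum_congr rfl fun v _ => by ring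
    simp only [Finset.sum_sub_distrib, ← Finset.mul_sum, h, sum_pauliForm_pauli,
      sum_permForm_pauli]
    linear_combination (-((finite_cliffordOrbit z).toFinset.card : ℂ)) * h2

/-! ### Norm bounds for the Pauli form -/

/-- The matrix of commutation signs is real and symmetric with pairwise orthogonal rows of squared
length d². -/
theorem parseval_comm (g : PauliLabel n → ℂ) :
    ∑ a, ‖∑ b, comm a b * g b‖ ^ 2 = (2 ^ n) ^ 2 * ∑ b, ‖g b‖ ^ 2 := by
  have hstar : ∀ a b : PauliLabel n, (starRingEnd ℂ) (comm a b) = comm a b := by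
    intro a b
    rcases comm_eq a b with h | h <;> simp [h]
  have key : ∑ a, (∑ b, comm a b * g b) * (starRingEnd ℂ) (∑ b, comm a b * g b)
      = (2 ^ n) ^ 2 * ∑ b, g b * (starRingEnd ℂ) (g b) := by
    simp only [map_sum, map_mul, hstar, Finset.sum_mul_sum]
    rw [Finset.sum_comm, Finset.mul_sum]
    refine Finset.sum_congr rfl fun b _ => ?_
    rw [Finset.sum_comm]
    have h : ∀ c, ∑ a, comm a b * g b * (comm a c * (starRingEnd ℂ) (g c))
        = if b = c then (2 ^ n) ^ 2 * (g b * (starRingEnd ℂ) (g c)) else 0 := by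
      intro c
      have h' : ∀ a, comm a b * g b * (comm a c * (starRingEnd ℂ) (g c))
          = comm b a * comm c a * (g b * (starRingEnd ℂ) (g c)) := fun a => by
        rw [comm_symm a b, comm_symm a c]; ring
      rw [Finset.sum_congr rfl fun a _ => h' a, ← Finset.sum_mul]
      split_ifs with hbc
      · rw [hbc, Finset.sum_congr rfl fun a _ => comm_sq c a, sum_one_label]
      · rw [sum_comm_mul_comm hbc, zero_mul]
    rw [Finset.sum_congr rfl fun c _ => h c]
    simp
  simp only [Complex.mul_conj, Complex.normSq_eq_norm_sq] at key
  exact_mod_cast key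

section

variable {Z : Mat n} (hZ : Z.IsHermitian)
include hZ

theorem star_trace_pauli_mul (a : PauliLabel n) :
    (starRingEnd ℂ) (trace (pauli a * Z)) = trace (pauli a * Z) := by
  rw [starRingEnd_apply, ← trace_conjTranspose, conjTranspose_mul, pauli_isHermitian, hZ.eq,
    trace_mul_comm]

theorem ofReal_charFn (a : PauliLabel n) : ((charFn Z a : ℝ) : ℂ) = trace (pauli a * Z) :=
  Complex.conj_eq_iff_re.mp (star_trace_pauli_mul hZ a)

theorem exists_eq_conj_diagonal : ∃ U : Matrix.unitaryGroup (Idx n) ℂ,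
    Z = (U : Mat n) * diagonal (fun k => (hZ.eigenvalues k : ℂ)) * (U : Mat n)ᴴ := by
  refine ⟨hZ.eigenvectorUnitary, ?_⟩
  conv_lhs => rw [hZ.spectral_theorem, Unitary.conjStarAlgAut_apply]
  rfl

theorem trace_eq_sum : trace Z = ((∑ k, hZ.eigenvalues k : ℝ) : ℂ) := by
  rw [hZ.trace_eq_sum_eigenvalues]
  push_cast
  rfl

theorem trace_pow_eq_sum (m : ℕ) : trace (Z ^ m) = ((∑ k, hZ.eigenvalues k ^ m : ℝ) : ℂ) := by
  obtain ⟨U, hU⟩ := exists_eq_conj_diagonal hZ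
  have h : ∀ m : ℕ, Z ^ m
      = (U : Mat n) * diagonal (fun k => (hZ.eigenvalues k : ℂ)) ^ m * (U : Mat n)ᴴ := by
    intro m
    induction m with
    | zero => rw [pow_zero, pow_zero, Matrix.mul_one, unitary_mul_conjTranspose]
    | succ m ih =>
      rw [pow_succ, ih, pow_succ]
      nth_rewrite 2 [hU]
      calc _ = (U : Mat n) * diagonal (fun k => (hZ.eigenvalues k : ℂ)) ^ m
            * ((U : Mat n)ᴴ * (U : Mat n)) * diagonal (fun k => (hZ.eigenvalues k : ℂ))
            * (U : Mat n)ᴴ := by simp only [Matrix.mul_assoc]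
        _ = _ := by rw [unitary_conjTranspose_mul]; simp only [Matrix.mul_assoc, Matrix.one_mul]
  rw [h, trace_mul_cycle, unitary_conjTranspose_mul, Matrix.one_mul, diagonal_pow, trace_diagonal]
  push_cast
  rfl

theorem frobNorm_sq : frobNorm Z ^ 2 = ∑ k, hZ.eigenvalues k ^ 2 := by
  have h := trace_pow_eq_sum hZ 2
  rw [sq] at h
  rw [frobNorm, h, Complex.ofReal_re, Real.sq_sqrt (Finset.sum_nonneg fun _ _ => sq_nonneg _)]

theorem ofReal_frobNorm_sq : ((frobNorm Z ^ 2 : ℝ) : ℂ) = trace (Z * Z) := by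
  rw [frobNorm_sq hZ, ← trace_pow_eq_sum hZ, sq]

theorem sum_charFn_sq : ∑ a, charFn Z a ^ 2 = 2 ^ n * frobNorm Z ^ 2 := by
  have h := sum_trace_mul_pauli_mul_trace Z Z
  rw [← ofReal_frobNorm_sq hZ, Finset.sum_congr rfl fun a _ => by
    rw [trace_mul_comm Z, ← ofReal_charFn hZ]] at h
  have h' : ((∑ a, charFn Z a * charFn Z a : ℝ) : ℂ) = ((2 ^ n * frobNorm Z ^ 2 : ℝ) : ℂ) := by
    push_cast at h ⊢
    exact h
  rw [← Complex.ofReal_injective h']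
  exact Finset.sum_congr rfl fun a _ => sq _

theorem permForm_self : permForm Z Z Z Z = ((
    (∑ k, hZ.eigenvalues k) ^ 4 + 6 * (∑ k, hZ.eigenvalues k ^ 2) * (∑ k, hZ.eigenvalues k) ^ 2
    + 3 * (∑ k, hZ.eigenvalues k ^ 2) ^ 2 + 8 * (∑ k, hZ.eigenvalues k ^ 3) * ∑ k, hZ.eigenvalues k
    + 6 * ∑ k, hZ.eigenvalues k ^ 4 : ℝ) : ℂ) := by
  have h2 := trace_pow_eq_sum hZ 2
  have h3 := trace_pow_eq_sum hZ 3
  have h4 := trace_pow_eq_sum hZ 4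
  have h1 := trace_eq_sum hZ
  rw [show Z ^ 2 = Z * Z by simp only [pow_succ, pow_zero, Matrix.one_mul]] at h2
  rw [show Z ^ 3 = Z * Z * Z by simp only [pow_succ, pow_zero, Matrix.one_mul]] at h3
  rw [show Z ^ 4 = Z * Z * Z * Z by simp only [pow_succ, pow_zero, Matrix.one_mul]] at h4
  unfold permForm
  rw [h1, h2, h3, h4]
  push_cast
  ring

/-- With t = tr Z and s = ‖Z‖₂², the cubic term is absorbed by λ²(t - λ)² ≥ 0, leaving t⁴ + 10 s t²
+ 3 s² + 10 Σ λ⁴. Since Σ λ⁴ ≤ s², the coefficient of s² is 3 + 10 = 13. -/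
theorem permForm_self_le : (permForm Z Z Z Z).re ≤ 13 * (frobNorm Z ^ 2 + Z.trace.re ^ 2) ^ 2 := by
  rw [permForm_self hZ, Complex.ofReal_re, frobNorm_sq hZ, trace_eq_sum hZ, Complex.ofReal_re]
  set t := ∑ k, hZ.eigenvalues k
  set s := ∑ k, hZ.eigenvalues k ^ 2
  have hs : 0 ≤ s := Finset.sum_nonneg fun _ _ => sq_nonneg _
  have h4 : ∑ k, hZ.eigenvalues k ^ 4 ≤ s ^ 2 := by
    have := Finset.sum_sq_le_sq_sum_of_nonneg (s := Finset.univ)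
      (f := fun k => hZ.eigenvalues k ^ 2) fun _ _ => sq_nonneg _
    simpa only [← pow_mul] using this
  have h3 : 8 * (∑ k, hZ.eigenvalues k ^ 3) * t ≤ 4 * t ^ 2 * s + 4 * ∑ k, hZ.eigenvalues k ^ 4 := by
    simp only [s, Finset.mul_sum, Finset.sum_mul, ← Finset.sum_add_distrib]
    refine Finset.sum_le_sum fun k _ => ?_
    nlinarith [mul_nonneg (sq_nonneg (hZ.eigenvalues k)) (sq_nonneg (t - hZ.eigenvalues k))]
  nlinarith [mul_nonneg hs (sq_nonneg t), sq_nonneg (t ^ 2)]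

/-- In an eigenbasis of Z, the Pauli operators become unitaries V_a with entries of modulus at most
1. Each trace of a power of V_a D expands with eigenvalue weights, and every one of the 24 terms,
summed over a, costs at most ‖Z‖₁² · d ‖Z‖₂². -/
theorem norm_pauliForm_self_le :
    ‖pauliForm Z Z Z Z‖ ≤ 24 * (nuclearNorm hZ ^ 2 * (2 ^ n * frobNorm Z ^ 2)) := by
  obtain ⟨U, hU⟩ := exists_eq_conj_diagonal hZ
  set lam := hZ.eigenvalues with hlam
  set D : Mat n := diagonal fun k => (lam k : ℂ) with hD
  set V : PauliLabel n → Mat n := fun a => (U : Mat n)ᴴ * pauli a * U with hV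
  set N : PauliLabel n → Mat n := fun a => V a * D * V a with hN
  set R : ℝ := 2 ^ n * frobNorm Z ^ 2 with hR
  have hUU := unitary_conjTranspose_mul U
  have hUU' := unitary_mul_conjTranspose U
  have hVentry : ∀ a k l, ‖V a k l‖ ≤ 1 := by
    intro a k l
    refine entry_norm_bound_of_unitary (?_ : V a ∈ Matrix.unitaryGroup (Idx n) ℂ) k l
    exact (U⁻¹ * pauliUnitary a * U).2
  -- conjugation by the eigenvector unitary
  have hpow : ∀ a, pauli a * Z = U * (V a * D) * (U : Mat n)ᴴ := by
    intro a
    conv_lhs => rw [hU]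
    calc _ = ((U : Mat n) * (U : Mat n)ᴴ) * pauli a * (U : Mat n) * D * (U : Mat n)ᴴ := by
          rw [hUU', Matrix.one_mul]; simp only [Matrix.mul_assoc]
      _ = _ := by simp only [hV, Matrix.mul_assoc]
  have hform : ∀ a, permForm (pauli a * Z) (pauli a * Z) (pauli a * Z) (pauli a * Z)
      = permForm (V a * D) (V a * D) (V a * D) (V a * D) := fun a => by
    rw [hpow, permForm_conj hUU]
  have htr : ∀ a, trace (V a * D) = charFn Z a := by
    intro a
    rw [ofReal_charFn hZ, hpow, trace_mul_cycle (U : Mat n), hUU, Matrix.one_mul]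
  -- W_a Z W_a is, up to the factor 2^n, the character transform of b ↦ tr(W_b Z) W_b. Parseval
  -- applied to each matrix entry, with |V_b(k,l)| ≤ 1, gives the bound.
  have hNsum : ∀ k l, ∑ a, ‖N a k l‖ ^ 2 ≤ R := by
    intro k l
    have h1 : ∀ a, (2 : ℂ) ^ n • N a
        = ∑ b, (comm a b * charFn Z b) • V b := by
      intro a
      have h2 : N a = (U : Mat n)ᴴ * (pauli a * Z * pauli a) * U := by
        rw [hpow]
        calc _ = V a * D * (U : Mat n)ᴴ * pauli a * U := by simp only [hN, hV, Matrix.mul_assoc]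
          _ = ((U : Mat n)ᴴ * (U : Mat n)) * (V a * D) * (U : Mat n)ᴴ * pauli a * U := by
            rw [hUU, Matrix.one_mul]
          _ = _ := by simp only [Matrix.mul_assoc]
      rw [h2, ← Matrix.smul_mul, ← Matrix.mul_smul, ← Matrix.smul_mul, ← Matrix.mul_smul,
        ← sum_trace_smul_pauli]
      simp only [Finset.mul_sum, Finset.sum_mul, Matrix.mul_smul, Matrix.smul_mul,
        pauli_conj_pauli, smul_smul]
      refine Finset.sum_congr rfl fun b _ => ?_
      rw [ofReal_charFn hZ, trace_mul_comm Z, mul_comm]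
    have h3 : ∀ a, (2 ^ n) ^ 2 * ‖N a k l‖ ^ 2 = ‖∑ b, comm a b * (charFn Z b * V b k l)‖ ^ 2 := by
      intro a
      have := congrFun (congrFun (h1 a) k) l
      simp only [Matrix.smul_apply, Matrix.sum_apply, smul_eq_mul, mul_assoc] at this
      rw [← this, norm_mul, mul_pow, norm_pow, Complex.norm_ofNat]
    have h4 := parseval_comm fun b => (charFn Z b * V b k l : ℂ)
    rw [← Finset.sum_congr rfl fun a _ => h3 a, ← Finset.mul_sum] at h4
    have h5 := mul_left_cancel₀ (pow_ne_zero 2 (pow_ne_zero n two_ne_zero)) h4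
    rw [h5, hR, ← sum_charFn_sq hZ]
    refine Finset.sum_le_sum fun b _ => ?_
    rw [norm_mul, mul_pow, Complex.norm_real, Real.norm_eq_abs, sq_abs]
    exact mul_le_of_le_one_right (sq_nonneg _) (pow_le_one₀ (norm_nonneg _) (hVentry b k l))
  have hμ : ∀ k, 0 ≤ |lam k| := fun k => abs_nonneg _
  have hnuc : nuclearNorm hZ = ∑ k, |lam k| := rfl
  have hnuc0 : 0 ≤ nuclearNorm hZ := Finset.sum_nonneg fun k _ => hμ k
  have hnuc2 : ∀ r : ℝ, nuclearNorm hZ ^ 2 * r = ∑ k, ∑ l, |lam k| * |lam l| * r := by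
    intro r
    rw [hnuc, sq, Finset.sum_mul_sum, Finset.sum_mul]
    exact Finset.sum_congr rfl fun k _ => Finset.sum_mul ..
  have hnorm : ∀ k, ‖(lam k : ℂ)‖ = |lam k| := fun k => by
    rw [Complex.norm_real, Real.norm_eq_abs]
  -- bounds for the traces of powers
  set w : PauliLabel n → ℝ := fun a => ‖trace (V a * D * (V a * D))‖ with hw
  set κ : PauliLabel n → ℝ := fun a => ‖trace (V a * D * (V a * D) * (V a * D))‖ with hκ
  set φ : PauliLabel n → ℝ := fun a => ‖trace (V a * D * (V a * D) * (V a * D) * (V a * D))‖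
    with hφ
  have hMM : ∀ a, V a * D * (V a * D) = N a * D := fun a => by simp only [hN, Matrix.mul_assoc]
  have hτ : ∀ a, |charFn Z a| ≤ nuclearNorm hZ := by
    intro a
    rw [← Real.norm_eq_abs, ← Complex.norm_real, ← htr, hnuc, trace]
    refine (norm_sum_le _ _).trans (Finset.sum_le_sum fun k _ => ?_)
    rw [diag_apply, hD, mul_diagonal, norm_mul, hnorm]
    exact mul_le_of_le_one_left (hμ k) (hVentry a k k)
  have hw_le : ∀ a, w a ≤ ∑ k, |lam k| * ‖N a k k‖ := by
    intro a
    simp only [hw, hMM, trace]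
    refine (norm_sum_le _ _).trans (Finset.sum_le_sum fun k _ => ?_)
    rw [diag_apply, hD, mul_diagonal, norm_mul, hnorm, mul_comm]
  have hκ_le : ∀ a, κ a ≤ ∑ k, ∑ l, |lam k| * |lam l| * ‖N a k l‖ := by
    intro a
    simp only [hκ, hMM, trace]
    refine (norm_sum_le _ _).trans (Finset.sum_le_sum fun k _ => ?_)
    rw [diag_apply, Matrix.mul_apply]
    refine (norm_sum_le _ _).trans (Finset.sum_le_sum fun l _ => ?_)
    rw [hD, mul_diagonal, mul_diagonal, norm_mul, norm_mul, norm_mul, hnorm, hnorm]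
    calc _ = |lam k| * |lam l| * ‖N a k l‖ * ‖V a l k‖ := by ring
      _ ≤ _ := mul_le_of_le_one_right
        (mul_nonneg (mul_nonneg (hμ k) (hμ l)) (norm_nonneg _)) (hVentry a l k)
  have hφ_le : ∀ a, φ a ≤ ∑ k, ∑ l, |lam k| * |lam l| * ((‖N a k l‖ ^ 2 + ‖N a l k‖ ^ 2) / 2) := by
    intro a
    have h4 : V a * D * (V a * D) * (V a * D) * (V a * D) = N a * D * (N a * D) := by
      simp only [hN, Matrix.mul_assoc]
    simp only [hφ, h4, trace]
    refine (norm_sum_le _ _).trans (Finset.sum_le_sum fun k _ => ?_)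
    rw [diag_apply, Matrix.mul_apply]
    refine (norm_sum_le _ _).trans (Finset.sum_le_sum fun l _ => ?_)
    rw [hD, mul_diagonal, mul_diagonal, norm_mul, norm_mul, norm_mul, hnorm, hnorm]
    calc _ = |lam k| * |lam l| * (‖N a k l‖ * ‖N a l k‖) := by ring
      _ ≤ _ := by
        refine mul_le_mul_of_nonneg_left ?_ (mul_nonneg (hμ k) (hμ l))
        linarith [two_mul_le_add_sq ‖N a k l‖ ‖N a l k‖]
  -- the sums over all Pauli labels
  have s1 : ∑ a, |charFn Z a| ^ 4 ≤ nuclearNorm hZ ^ 2 * R := by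
    rw [hR, ← sum_charFn_sq hZ, Finset.mul_sum]
    refine Finset.sum_le_sum fun a _ => ?_
    rw [← sq_abs (charFn Z a)]
    calc _ = |charFn Z a| ^ 2 * |charFn Z a| ^ 2 := by ring
      _ ≤ _ := mul_le_mul_of_nonneg_right (pow_le_pow_left₀ (abs_nonneg _) (hτ a) 2) (sq_nonneg _)
  have s2 : ∑ a, w a ^ 2 ≤ nuclearNorm hZ ^ 2 * R := by
    -- Cauchy–Schwarz with weights |λ_k|, whose total mass is the nuclear norm.
    have h : ∀ a, w a ^ 2 ≤ nuclearNorm hZ * ∑ k, |lam k| * ‖N a k k‖ ^ 2 := fun a =>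
      (pow_le_pow_left₀ (norm_nonneg _) (hw_le a) 2).trans
        (Finset.sum_sq_le_sum_mul_sum_of_sq_le_mul _ (fun k _ => hμ k)
          (fun k _ => mul_nonneg (hμ k) (sq_nonneg _)) fun k _ => le_of_eq (by ring))
    refine (Finset.sum_le_sum fun a _ => h a).trans ?_
    rw [← Finset.mul_sum, Finset.sum_comm, sq, mul_assoc]
    refine mul_le_mul_of_nonneg_left ?_ hnuc0
    rw [hnuc, Finset.sum_mul]
    refine Finset.sum_le_sum fun k _ => ?_
    rw [← Finset.mul_sum]
    exact mul_le_mul_of_nonneg_left (hNsum k k) (hμ k)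
  have hR2 : ∑ a, |charFn Z a| ^ 2 = R := by
    rw [hR, ← sum_charFn_sq hZ]
    exact Finset.sum_congr rfl fun a _ => sq_abs _
  have s3 : ∑ a, κ a * |charFn Z a| ≤ nuclearNorm hZ ^ 2 * R := by
    have h : ∀ a, κ a * |charFn Z a|
        ≤ ∑ k, ∑ l, |lam k| * |lam l| * ((‖N a k l‖ ^ 2 + |charFn Z a| ^ 2) / 2) := by
      intro a
      refine (mul_le_mul_of_nonneg_right (hκ_le a) (abs_nonneg _)).trans ?_
      simp only [Finset.sum_mul]
      refine Finset.sum_le_sum fun k _ => Finset.sum_le_sum fun l _ => ?_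
      rw [mul_assoc]
      refine mul_le_mul_of_nonneg_left ?_ (mul_nonneg (hμ k) (hμ l))
      linarith [two_mul_le_add_sq ‖N a k l‖ |charFn Z a|]
    refine (Finset.sum_le_sum fun a _ => h a).trans ?_
    rw [hnuc2, Finset.sum_comm]
    refine Finset.sum_le_sum fun k _ => ?_
    rw [Finset.sum_comm]
    refine Finset.sum_le_sum fun l _ => ?_
    rw [← Finset.mul_sum, ← Finset.sum_div, Finset.sum_add_distrib, hR2]
    refine mul_le_mul_of_nonneg_left ?_ (mul_nonneg (hμ k) (hμ l))
    linarith [hNsum k l]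
  have s4 : ∑ a, φ a ≤ nuclearNorm hZ ^ 2 * R := by
    refine (Finset.sum_le_sum fun a _ => hφ_le a).trans ?_
    rw [hnuc2, Finset.sum_comm]
    refine Finset.sum_le_sum fun k _ => ?_
    rw [Finset.sum_comm]
    refine Finset.sum_le_sum fun l _ => ?_
    rw [← Finset.mul_sum, ← Finset.sum_div, Finset.sum_add_distrib]
    refine mul_le_mul_of_nonneg_left ?_ (mul_nonneg (hμ k) (hμ l))
    linarith [hNsum k l, hNsum l k]
  -- The cycle-type multiplicities are 1, 6, 3, 8, 6. Splitting the second as 6wτ² ≤ 3w² + 3τ⁴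
  -- leaves 4, 6, 8, 6, still of total 24.
  have hterm : ∀ a, ‖permForm (pauli a * Z) (pauli a * Z) (pauli a * Z) (pauli a * Z)‖
      ≤ 4 * |charFn Z a| ^ 4 + 6 * w a ^ 2 + 8 * (κ a * |charFn Z a|) + 6 * φ a := by
    intro a
    have hτn : ‖trace (V a * D)‖ = |charFn Z a| := by
      rw [htr, Complex.norm_real, Real.norm_eq_abs]
    have he : permForm (V a * D) (V a * D) (V a * D) (V a * D)
        = trace (V a * D) ^ 4
          + 6 * trace (V a * D * (V a * D)) * trace (V a * D) ^ 2
          + 3 * trace (V a * D * (V a * D)) ^ 2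
          + 8 * trace (V a * D * (V a * D) * (V a * D)) * trace (V a * D)
          + 6 * trace (V a * D * (V a * D) * (V a * D) * (V a * D)) := by
      unfold permForm
      ring
    rw [hform, he]
    refine (norm_add_le _ _).trans ?_
    refine (add_le_add_left ((norm_add_le _ _).trans (add_le_add_left ((norm_add_le _ _).trans
      (add_le_add_left (norm_add_le _ _) _)) _)) _).trans ?_
    simp only [norm_mul, norm_pow, hτn, Complex.norm_ofNat]
    have h := two_mul_le_add_sq (w a) (|charFn Z a| ^ 2)
    simp only [hw, hκ, hφ] at h ⊢
    linarith
  unfold pauliForm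
  refine (norm_sum_le _ _).trans ((Finset.sum_le_sum fun a _ => hterm a).trans ?_)
  simp only [Finset.sum_add_distrib, ← Finset.mul_sum]
  linarith

end

/-! ### Expectations over the Clifford orbit -/

instance instMeasurableSingletonClassMat (n : ℕ) : MeasurableSingletonClass (Mat n) :=
  inferInstanceAs (MeasurableSingletonClass (Idx n → Idx n → ℂ))

theorem integrableOn_count {α : Type*} [MeasurableSpace α] [MeasurableSingletonClass α]
    (s : Finset α) (f : α → ℝ) : IntegrableOn f (s : Set α) Measure.count := by
  have hfin : IsFiniteMeasure (Measure.count.restrict (s : Set α)) :=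
    ⟨by simp [Measure.count_apply_finset]⟩
  have h : IntegrableOn f (s : Set α) (Measure.count.restrict (s : Set α)) := .finset
  rwa [IntegrableOn, Measure.restrict_restrict s.measurableSet, Set.inter_self] at h

theorem integrable_uniformOn {α : Type*} [MeasurableSpace α] [MeasurableSingletonClass α]
    {s : Set α} (hs : s.Finite) (f : α → ℝ) : Integrable f (uniformOn s) := by
  rcases s.eq_empty_or_nonempty with rfl | hne
  · simp
  rw [uniformOn, ProbabilityTheory.cond]
  refine Integrable.smul_measure ?_ ?_
  · rw [← hs.coe_toFinset]
    exact integrableOn_count hs.toFinset f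
  · simp [hne.ne_empty]

theorem integral_uniformOn {α : Type*} [MeasurableSpace α] [MeasurableSingletonClass α]
    {s : Set α} (hs : s.Finite) (f : α → ℝ) :
    ∫ x, f x ∂(uniformOn s) = (hs.toFinset.card : ℝ)⁻¹ * ∑ x ∈ hs.toFinset, f x := by
  rw [uniformOn, ProbabilityTheory.cond, integral_smul_measure, Measure.count_apply_finite s hs]
  have h : ∫ x in s, f x ∂Measure.count = ∫ x in (hs.toFinset : Set α), f x ∂Measure.count := by
    rw [hs.coe_toFinset]
  rw [h, setIntegral_finset _ (integrableOn_count hs.toFinset f)]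
  simp

theorem proj_mem_cliffordOrbit (z : Vec n) : proj z ∈ cliffordOrbit z :=
  ⟨1, one_mem _, by simp⟩

theorem quadForm_eq (Z : Mat n) (v : Vec n) : quadForm Z v = (trace (Z * proj v)).re := by
  have h : inner ℂ v (Matrix.toEuclideanLin Z v) = trace (Z * proj v) := by
    rw [proj_eq, mul_vecMulVec, trace_vecMulVec, EuclideanSpace.inner_eq_star_dotProduct]
    rfl
  rw [quadForm, h]

theorem ofReal_trace_mul_re {Z M : Mat n} (hZ : Z.IsHermitian) (hM : Mᴴ = M) :
    (((trace (Z * M)).re : ℝ) : ℂ) = trace (Z * M) := by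
  refine Complex.conj_eq_iff_re.mp ?_
  rw [starRingEnd_apply, ← trace_conjTranspose, conjTranspose_mul, hZ.eq, hM, trace_mul_comm]

section

variable {Ω : Type*} [MeasurableSpace Ω] {P : Measure Ω} {a : Ω → Vec n} {z : Vec n}
  (h : IsUniformOnOrbit P a z)
include h

theorem IsUniformOnOrbit.aemeasurable : AEMeasurable (fun ω => proj (a ω)) P := by
  -- A map that is not a.e. measurable has zero push-forward, whereas the uniform law is a
  -- probability measure.
  refine AEMeasurable.of_map_ne_zero ?_
  have hP := isProbabilityMeasure_uniformOn (finite_cliffordOrbit z) ⟨_, proj_mem_cliffordOrbit z⟩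
  rw [show P.map (fun ω => proj (a ω)) = uniformOn (cliffordOrbit z) from h]
  exact hP.ne_zero

theorem IsUniformOnOrbit.integrable (f : Mat n → ℝ) : Integrable (fun ω => f (proj (a ω))) P := by
  have hf := integrable_uniformOn (finite_cliffordOrbit z) f
  rw [← show P.map (fun ω => proj (a ω)) = uniformOn (cliffordOrbit z) from h] at hf
  exact hf.comp_aemeasurable h.aemeasurable

theorem IsUniformOnOrbit.integral (f : Mat n → ℝ) :
    ∫ ω, f (proj (a ω)) ∂P = ((finite_cliffordOrbit z).toFinset.card : ℝ)⁻¹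
      * ∑ M ∈ (finite_cliffordOrbit z).toFinset, f M := by
  have hf := integrable_uniformOn (finite_cliffordOrbit z) f
  have he := show P.map (fun ω => proj (a ω)) = uniformOn (cliffordOrbit z) from h
  rw [← integral_uniformOn, ← he, integral_map h.aemeasurable]
  rw [he]
  exact hf.aestronglyMeasurable

end

/-! ### Second moment, coefficients and bound for the fourth moment -/

theorem card_orbit_ne_zero (z : Vec n) : ((finite_cliffordOrbit z).toFinset.card : ℂ) ≠ 0 := by
  rw [Nat.cast_ne_zero, Finset.card_ne_zero]
  exact ⟨_, (finite_cliffordOrbit z).mem_toFinset.mpr (proj_mem_cliffordOrbit z)⟩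

theorem second_moment {z : Vec n} (hz : ‖z‖ = 1) {Z : Mat n} (hZ : Z.IsHermitian) :
    ((finite_cliffordOrbit z).toFinset.card : ℝ)⁻¹
      * ∑ M ∈ (finite_cliffordOrbit z).toFinset, (trace (Z * M)).re ^ 2
      = (frobNorm Z ^ 2 + Z.trace.re ^ 2) / (((2 : ℝ) ^ n + 1) * (2 : ℝ) ^ n) := by
  have h := orbitForm₂_eq hz Z Z
  have h1 : ((∑ M ∈ (finite_cliffordOrbit z).toFinset, (trace (Z * M)).re ^ 2 : ℝ) : ℂ)
      = orbitForm₂ z Z Z := by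
    unfold orbitForm₂
    push_cast
    refine Finset.sum_congr rfl fun M hM => ?_
    rw [ofReal_trace_mul_re hZ (orbit_conjTranspose ((finite_cliffordOrbit z).mem_toFinset.mp hM)),
      sq]
  have ht : ((Z.trace.re : ℝ) : ℂ) = trace Z := by
    rw [trace_eq_sum hZ, Complex.ofReal_re]
  have hN := card_orbit_ne_zero z
  have := two_pow_ne_zero (n := n)
  have := two_pow_add_one_ne_zero (n := n)
  apply Complex.ofReal_injective
  rw [Complex.ofReal_mul, h1, h, ← ofReal_frobNorm_sq hZ]
  push_cast
  rw [ht]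
  field_simp

theorem l4norm_pow_four (f : PauliLabel n → ℝ) : l4norm f ^ 4 = ∑ a, f a ^ 4 := by
  have h0 : 0 ≤ ∑ a, |f a| ^ 4 := Finset.sum_nonneg fun a _ => by positivity
  rw [l4norm, ← Real.rpow_natCast, ← Real.rpow_mul h0]
  norm_num
  refine Finset.sum_congr rfl fun a _ => ?_
  rw [show (4 : ℕ) = 2 * 2 from rfl, pow_mul, pow_mul, sq_abs]

theorem sum_charFn_proj_sq {z : Vec n} (hz : ‖z‖ = 1) :
    ∑ a, charFn (proj z) a ^ 2 = 2 ^ n := by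
  have h := proj_mul_mul_proj z 1
  rw [Matrix.mul_one, Matrix.one_mul, trace_proj hz, one_smul] at h
  rw [sum_charFn_sq (conjTranspose_proj z), frobNorm, h, trace_proj hz]
  simp

theorem charFn_proj_zero {z : Vec n} (hz : ‖z‖ = 1) : charFn (proj z) 0 = 1 := by
  rw [charFn, pauli_zero, Matrix.one_mul, trace_proj hz, Complex.one_re]

theorem l4norm_le {z : Vec n} (hz : ‖z‖ = 1) : l4norm (charFn (proj z)) ^ 4 ≤ (2 ^ n) ^ 2 := by
  rw [l4norm_pow_four, ← sum_charFn_proj_sq hz]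
  have := Finset.sum_sq_le_sq_sum_of_nonneg (s := Finset.univ)
    (f := fun a => charFn (proj z) a ^ 2) fun _ _ => sq_nonneg _
  simpa only [← pow_mul] using this

/-- The label 0 contributes 1 to the fourth powers. Cauchy–Schwarz over the other d² - 1 labels,
whose squares sum to d - 1, gives (d - 1)/(d + 1). -/
theorem le_l4norm {z : Vec n} (hz : ‖z‖ = 1) :
    2 * 2 ^ n ≤ l4norm (charFn (proj z)) ^ 4 * (2 ^ n + 1) := by
  rw [l4norm_pow_four]
  have hc : ((Finset.univ.erase (0 : PauliLabel n)).card : ℝ) = (2 ^ n) ^ 2 - 1 := by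
    have := card_label (n := n)
    rw [Finset.card_erase_of_mem (Finset.mem_univ _), Finset.card_univ,
      Nat.cast_sub Fintype.card_pos]
    push_cast
    congr 1
    exact_mod_cast this
  have h2 := sum_charFn_proj_sq hz
  rw [← Finset.add_sum_erase _ _ (Finset.mem_univ (0 : PauliLabel n)), charFn_proj_zero hz] at h2 ⊢
  have h := sq_sum_le_card_mul_sum_sq (s := Finset.univ.erase (0 : PauliLabel n))
    (f := fun a => charFn (proj z) a ^ 2)
  rw [hc] at h
  have hsq : ∀ a, (charFn (proj z) a ^ 2) ^ 2 = charFn (proj z) a ^ 4 := fun a => by ring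
  simp only [hsq] at h
  have hd : (1 : ℝ) ≤ 2 ^ n := one_le_pow₀ one_le_two
  set d : ℝ := 2 ^ n
  set S := ∑ a ∈ Finset.univ.erase (0 : PauliLabel n), charFn (proj z) a ^ 4
  have h3 : ∑ a ∈ Finset.univ.erase (0 : PauliLabel n), charFn (proj z) a ^ 2 = d - 1 := by
    linarith
  rw [h3] at h
  have hS : 0 ≤ S := Finset.sum_nonneg fun a _ => by positivity
  change 2 * d ≤ (1 ^ 4 + S) * (d + 1)
  rcases hd.eq_or_lt with h1 | h1
  · rw [← h1]; linarith
  · have : (d - 1) * (d - 1) ≤ (d - 1) * ((d + 1) * S) := by nlinarith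
    have := le_of_mul_le_mul_left this (by linarith)
    linarith

theorem fourth_moment {z : Vec n} (hz : ‖z‖ = 1) {Z : Mat n} (hZ : Z.IsHermitian) {p q : ℝ}
    (h1 : p * (4 * (2 ^ n) ^ 2 * (2 ^ n + 1) * (2 ^ n + 2))
      + q * (2 ^ n * (2 ^ n + 1) * (2 ^ n + 2) * (2 ^ n + 3)) = 1)
    (h2 : p * ((2 ^ n) ^ 2 * (4 * (2 ^ n) ^ 2 * (2 ^ n + 1) * (2 ^ n + 2)))
      + q * (4 * (2 ^ n) ^ 2 * (2 ^ n + 1) * (2 ^ n + 2)) = l4norm (charFn (proj z)) ^ 4) :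
    ((finite_cliffordOrbit z).toFinset.card : ℝ)⁻¹
      * ∑ M ∈ (finite_cliffordOrbit z).toFinset, (trace (Z * M)).re ^ 4
      = p * (pauliForm Z Z Z Z).re + q * (permForm Z Z Z Z).re := by
  have h2' : (p : ℂ) * ((2 ^ n) ^ 2 * (4 * (2 ^ n) ^ 2 * (2 ^ n + 1) * (2 ^ n + 2)))
      + q * (4 * (2 ^ n) ^ 2 * (2 ^ n + 1) * (2 ^ n + 2)) = ∑ a, trace (pauli a * proj z) ^ 4 := by
    rw [l4norm_pow_four] at h2
    rw [Finset.sum_congr rfl fun a _ => by rw [← ofReal_charFn (conjTranspose_proj z)]]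
    exact_mod_cast h2
  have h := orbitForm₄_eq hz (p := p) (q := q) (by exact_mod_cast h1) h2' Z Z Z Z
  have h3 : ((∑ M ∈ (finite_cliffordOrbit z).toFinset, (trace (Z * M)).re ^ 4 : ℝ) : ℂ)
      = orbitForm₄ z Z Z Z Z := by
    unfold orbitForm₄
    push_cast
    refine Finset.sum_congr rfl fun M hM => ?_
    rw [ofReal_trace_mul_re hZ (orbit_conjTranspose ((finite_cliffordOrbit z).mem_toFinset.mp hM))]
    ring
  have h4 : ((((finite_cliffordOrbit z).toFinset.card : ℝ)⁻¹
      * ∑ M ∈ (finite_cliffordOrbit z).toFinset, (trace (Z * M)).re ^ 4 : ℝ) : ℂ)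
      = p * pauliForm Z Z Z Z + q * permForm Z Z Z Z := by
    rw [Complex.ofReal_mul, h3, h, ← mul_assoc]
    push_cast
    rw [inv_mul_cancel₀ (card_orbit_ne_zero z), one_mul]
  have h5 := congrArg Complex.re h4
  rwa [Complex.ofReal_re, Complex.add_re, Complex.re_ofReal_mul, Complex.re_ofReal_mul] at h5

/-- The coefficients of the fourth moment operator of a Clifford orbit. -/
theorem exists_coefficients {z : Vec n} (hz : ‖z‖ = 1) : ∃ p q : ℝ,
    p * (4 * (2 ^ n) ^ 2 * (2 ^ n + 1) * (2 ^ n + 2))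
      + q * (2 ^ n * (2 ^ n + 1) * (2 ^ n + 2) * (2 ^ n + 3)) = 1 ∧
    p * ((2 ^ n) ^ 2 * (4 * (2 ^ n) ^ 2 * (2 ^ n + 1) * (2 ^ n + 2)))
      + q * (4 * (2 ^ n) ^ 2 * (2 ^ n + 1) * (2 ^ n + 2)) = l4norm (charFn (proj z)) ^ 4 ∧
    |p| ≤ l4norm (charFn (proj z)) ^ 4 / (4 * (2 ^ n) ^ 4 * (2 ^ n + 1) * (2 ^ n + 2)) ∧
    0 ≤ q ∧ q ≤ 1 / (((2 ^ n + 1) * 2 ^ n) ^ 2) := by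
  have hup := l4norm_le hz
  have hlow := le_l4norm hz
  have hL0 : 0 ≤ l4norm (charFn (proj z)) ^ 4 := by positivity
  set L := l4norm (charFn (proj z)) ^ 4
  have hd1 : n = 0 ∨ (2 : ℝ) ≤ 2 ^ n := by
    rcases Nat.eq_zero_or_pos n with h | h
    · exact Or.inl h
    · right
      calc (2 : ℝ) = 2 ^ 1 := (pow_one 2).symm
        _ ≤ 2 ^ n := pow_le_pow_right₀ one_le_two h
  rcases hd1 with rfl | hd
  -- For d = 1 the two equations coincide, and any p + q = 1/24 solves them.
  · have hL : L = 1 := by norm_num at hup hlow; linarith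
    refine ⟨1 / 24, 0, ?_, ?_, ?_, le_rfl, ?_⟩ <;> norm_num [hL]
  set d : ℝ := 2 ^ n
  have hd0 : 0 < d := by linarith
  have hd1 : 0 < d - 1 := by linarith
  have hq0 : 0 ≤ (d ^ 2 - L) / (d ^ 2 * (d + 1) * (d + 2) * (d + 4) * (d - 1)) :=
    div_nonneg (by linarith) (by positivity)
  -- With α = L / (4d²(d+1)(d+2)), the solution has p = (α - q)/d². The lower bound on L gives q ≤
  -- 2α, hence |α - q| ≤ α.
  have hq : (d ^ 2 - L) / (d ^ 2 * (d + 1) * (d + 2) * (d + 4) * (d - 1))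
      ≤ 2 * (L / (4 * d ^ 2 * (d + 1) * (d + 2))) := by
    rw [← mul_div_assoc, div_le_div_iff₀ (by positivity) (by positivity)]
    have h : 2 * (d ^ 2 - L) ≤ L * ((d + 4) * (d - 1)) := by nlinarith
    have h0 : 0 ≤ 2 * (d ^ 2 * (d + 1) * (d + 2)) := by positivity
    nlinarith [mul_le_mul_of_nonneg_left h h0]
  refine ⟨(L / (4 * d ^ 2 * (d + 1) * (d + 2))
    - (d ^ 2 - L) / (d ^ 2 * (d + 1) * (d + 2) * (d + 4) * (d - 1))) / d ^ 2,
    (d ^ 2 - L) / (d ^ 2 * (d + 1) * (d + 2) * (d + 4) * (d - 1)), ?_, ?_, ?_, hq0, ?_⟩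
  · field_simp
    ring
  · field_simp
    ring
  · have h : L / (4 * d ^ 4 * (d + 1) * (d + 2)) = L / (4 * d ^ 2 * (d + 1) * (d + 2)) / d ^ 2 := by
      field_simp
    rw [h, abs_div, abs_of_pos (by positivity : 0 < d ^ 2)]
    refine div_le_div_of_nonneg_right ?_ (by positivity)
    rw [abs_le]
    constructor <;> linarith
  · rw [div_le_div_iff₀ (by positivity) (by positivity)]
    have h : (d ^ 2 - L) ≤ d ^ 2 := by linarith
    have h' : d ^ 2 * (d + 1) ≤ (d + 2) * (d + 4) * (d - 1) := by nlinarith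
    have h3 : 0 ≤ ((d + 1) * d) ^ 2 := by positivity
    have h4 : 0 ≤ d ^ 2 * (d + 1) := by positivity
    nlinarith [mul_le_mul_of_nonneg_right h h3, mul_le_mul_of_nonneg_left h' h4]

theorem fourth_moment_le {z : Vec n} (hz : ‖z‖ = 1) {Z : Mat n} (hZ : Z.IsHermitian) :
    ((finite_cliffordOrbit z).toFinset.card : ℝ)⁻¹
      * ∑ M ∈ (finite_cliffordOrbit z).toFinset, (trace (Z * M)).re ^ 4
      ≤ (6 / (2 : ℝ) ^ n * l4norm (charFn (proj z)) ^ 4 *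
            (nuclearNorm hZ ^ 2 / frobNorm Z ^ 2) + 13) *
          ((frobNorm Z ^ 2 + Z.trace.re ^ 2) / (((2 : ℝ) ^ n + 1) * (2 : ℝ) ^ n)) ^ 2 := by
  obtain ⟨p, q, h1, h2, hp, hq0, hq⟩ := exists_coefficients hz
  rw [fourth_moment hz hZ h1 h2]
  have hX := norm_pauliForm_self_le hZ
  have hY := permForm_self_le hZ
  have hL : 0 ≤ l4norm (charFn (proj z)) ^ 4 := by positivity
  set L := l4norm (charFn (proj z)) ^ 4
  set d : ℝ := 2 ^ n with hd
  have hd0 : 0 < d := by positivity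
  set s := frobNorm Z ^ 2
  have hs : 0 ≤ s := sq_nonneg _
  set t := Z.trace.re
  set N := nuclearNorm hZ ^ 2
  have hN : 0 ≤ N := sq_nonneg _
  have e1 : p * (pauliForm Z Z Z Z).re ≤ 6 / d * L * (N * s) / ((d + 1) * d) ^ 2 := by
    calc p * (pauliForm Z Z Z Z).re ≤ |p| * ‖pauliForm Z Z Z Z‖ := by
          refine (le_abs_self _).trans ?_
          rw [abs_mul]
          exact mul_le_mul_of_nonneg_left (Complex.abs_re_le_norm _) (abs_nonneg _)
      -- The constant 6 is 24/4; the next inequality weakens d + 2 to d + 1 to match the squared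
      -- second moment.
      _ ≤ L / (4 * d ^ 4 * (d + 1) * (d + 2)) * (24 * (N * (d * s))) :=
          mul_le_mul hp hX (norm_nonneg _) (by positivity)
      _ = 6 * L * (N * s) / (d ^ 3 * (d + 1) * (d + 2)) := by field_simp; ring
      _ ≤ 6 * L * (N * s) / (d ^ 3 * (d + 1) * (d + 1)) := by
          refine div_le_div_of_nonneg_left (by positivity) (by positivity) ?_
          exact mul_le_mul_of_nonneg_left (by linarith) (by positivity)
      _ = _ := by field_simp
  have e2 : q * (permForm Z Z Z Z).re ≤ 13 * (s + t ^ 2) ^ 2 / ((d + 1) * d) ^ 2 := by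
    calc _ ≤ q * (13 * (s + t ^ 2) ^ 2) := mul_le_mul_of_nonneg_left hY hq0
      _ ≤ 1 / ((d + 1) * d) ^ 2 * (13 * (s + t ^ 2) ^ 2) :=
          mul_le_mul_of_nonneg_right hq (by positivity)
      _ = _ := by ring
  -- If s = 0 then both sides are 0 by the convention N / 0 = 0; otherwise N s = (N/s) s² and s ≤ s
  -- + t².
  have e3 : N * s ≤ N / s * (s + t ^ 2) ^ 2 := by
    rcases hs.eq_or_lt with h0 | h0
    · rw [← h0]; simp
    · calc N * s = N / s * s ^ 2 := by field_simp
        _ ≤ _ := mul_le_mul_of_nonneg_left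
          (pow_le_pow_left₀ hs (by linarith [sq_nonneg t]) 2) (by positivity)
  calc _ ≤ 6 / d * L * (N * s) / ((d + 1) * d) ^ 2
        + 13 * (s + t ^ 2) ^ 2 / ((d + 1) * d) ^ 2 := add_le_add e1 e2
    _ ≤ 6 / d * L * (N / s * (s + t ^ 2) ^ 2) / ((d + 1) * d) ^ 2
        + 13 * (s + t ^ 2) ^ 2 / ((d + 1) * d) ^ 2 := by gcongr
    _ = _ := by rw [div_pow]; ring

end CliffordOrbit

theorem mainTheorem5 (n : ℕ) (z : Vec n) (hz : ‖z‖ = 1) :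
    (cliffordOrbit z).Finite ∧
    ∀ {Ω : Type*} [MeasurableSpace Ω] (P : Measure Ω) [IsProbabilityMeasure P]
      (a : Ω → Vec n), IsUniformOnOrbit P a z →
      ∀ (Z : Mat n) (hZ : Z.IsHermitian),
        (Integrable (fun ω => quadForm Z (a ω) ^ 2) P ∧
          ∫ ω, quadForm Z (a ω) ^ 2 ∂P =
            (frobNorm Z ^ 2 + Z.trace.re ^ 2) / (((2 : ℝ) ^ n + 1) * (2 : ℝ) ^ n)) ∧
        (Integrable (fun ω => quadForm Z (a ω) ^ 4) P ∧
          ∫ ω, quadForm Z (a ω) ^ 4 ∂P ≤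
            (6 / (2 : ℝ) ^ n * l4norm (charFn (proj z)) ^ 4 *
                (nuclearNorm hZ ^ 2 / frobNorm Z ^ 2) + 13) *
              (∫ ω, quadForm Z (a ω) ^ 2 ∂P) ^ 2) := by
  refine ⟨finite_cliffordOrbit z, fun P _ a ha Z hZ => ?_⟩
  -- ⟨a, Za⟩ depends on `a` only through a a*, so the law of the projector suffices and the phase is
  -- irrelevant.
  simp only [quadForm_eq]
  have h2 : ∫ ω, (trace (Z * proj (a ω))).re ^ 2 ∂P
      = (frobNorm Z ^ 2 + Z.trace.re ^ 2) / (((2 : ℝ) ^ n + 1) * (2 : ℝ) ^ n) := by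
    rw [ha.integral fun M => (trace (Z * M)).re ^ 2, second_moment hz hZ]
  refine ⟨⟨ha.integrable fun M => (trace (Z * M)).re ^ 2, h2⟩,
    ha.integrable fun M => (trace (Z * M)).re ^ 4, ?_⟩
  rw [h2, ha.integral fun M => (trace (Z * M)).re ^ 4]
  exact fourth_moment_le hz hZ
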